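/- Let $\mathfrak H$ be a real separable Hilbert space and let $X=\{X(h):h\in\mathfrak H\}$ be an isonormal Gaussian process over $\mathfrak H$ on a probability space $(\Omega,\mathscr F,P)$, that is, a centered Gaussian family with $E[X(h)X(g)]=\langle h,g\rangle_{\mathfrak H}$ for all $h,g\in\mathfrak H$. For a smooth cylindrical random variable $F=g(X(\phi_1),\dots,X(\phi_n))$, with $n\ge 1$, $\phi_i\in\mathfrak H$ and $g:\mathbb R^n\to\mathbb R$ smooth with compact support, put $DF=\sum_{i=1}^n\frac{\partial g}{\partial x_i}(X(\phi_1),\dots,X(\phi_n))\,\phi_i$. Let $D:\mathbb D^{1,2}\to L^2(\Omega;\mathfrak H)$ be the closure of this operator in $L^2(\Omega)\times L^2(\Omega;\mathfrak H)$; thus $\mathbb D^{1,2}$ is the closure of the smooth cylindrical random variables with respect to the norm $(E[F^2]+E\|DF\|_{\mathfrak H}^2)^{1/2}$. For $q\ge 1$ let $J_q$ be the orthogonal projection of $L^2(\Omega)$ onto the $q$th Wiener chaos, i.e. the closed linear span of the random variables $H_q(X(h))$, $h\in\mathfrak H$, $\|h\|_{\mathfrak H}=1$, where $H_q$ is the $q$th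 Hermite polynomial, and put $L^{-1}F=-\sum_{q\ge 1}\frac1q J_qF$ for $F\in\mathbb D^{1,2}$ with $E(F)=0$. For real random variables $Y,Z$ and a class $\mathscr H$ of functions $h:\mathbb R\to\mathbb R$ put $d_{\mathscr H}(Y,Z)=\sup\{|E(h(Y))-E(h(Z))|:h\in\mathscr H\}$. The distances $d_{\rm W}$, $d_{\rm FM}$, $d_{\rm TV}$, $d_{\rm Kol}$ correspond respectively to $\mathscr H=\{h:\|h\|_L\le 1\}$, to $\mathscr H=\{h:\|h\|_L+\|h\|_\infty\le 1\}$ (with $\|\cdot\|_L$ the Lipschitz seminorm), to the indicators of Borel sets, and to the indicators of the half-lines $(-\infty,z]$, $z\in\mathbb R$. **Theorem.** Let $Z\sim\mathscr N(0,1)$, possibly defined on another probability space, and let $F\in\mathbb D^{1,2}$ be such that $E(F)=0$. Then $L^{-1}F\in\mathbb D^{1,2}$ and, with $$B(F)=E\big[(1-\langle DF,-DL^{-1}F\rangle_{\mathfrak H})^2\big]^{1/2}\in[0,\infty],$$ one has $$d_{\rm W}(F,Z)\le B(F),\qquad d_{\rm FM}(F,Z)\le 4\,B(F).$$ If, in addition,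 the law of $F$ is absolutely continuous with respect to the Lebesgue measure, then $$d_{\rm Kol}(F,Z)\le B(F),\qquad d_{\rm TV}(F,Z)\le 2\,B(F).$$ -/

import Mathlib

open MeasureTheory ProbabilityTheory Set
open scoped ENNReal NNReal

noncomputable section

namespace Malliavin

section Distances

variable {Ω Ω' : Type*} [MeasurableSpace Ω] [MeasurableSpace Ω']

/-- The distance `d_𝓗(X, Y) = sup {|E h(X) - E h(Y)| : h ∈ 𝓗}` between (the laws of) two real random
variables `X` and `Y`, defined on probability spaces `(Ω, P)` and `(Ω', Q)`. -/
def classDist (𝓗 : Set (ℝ → ℝ)) (P : Measure Ω) (X : Ω → ℝ) (Q : Measure Ω') (Y : Ω' → ℝ) : ℝ≥0∞ :=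
  ⨆ h ∈ 𝓗, ENNReal.ofReal |(∫ ω, h (X ω) ∂P) - ∫ ω, h (Y ω) ∂Q|

/-- Wasserstein distance: test functions with Lipschitz seminorm at most one (used for integrable
random variables). -/
def dW (P : Measure Ω) (X : Ω → ℝ) (Q : Measure Ω') (Y : Ω' → ℝ) : ℝ≥0∞ :=
  classDist {h | LipschitzWith 1 h} P X Q Y

/-- Fortet-Mourier distance: test functions with `‖h‖_L + ‖h‖_∞ ≤ 1`. -/
def dFM (P : Measure Ω) (X : Ω → ℝ) (Q : Measure Ω') (Y : Ω' → ℝ) : ℝ≥0∞ :=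
  classDist {h | ∃ K M : ℝ≥0, LipschitzWith K h ∧ (∀ x, |h x| ≤ M) ∧ K + M ≤ 1} P X Q Y

/-- Total variation distance: indicators of Borel sets. -/
def dTV (P : Measure Ω) (X : Ω → ℝ) (Q : Measure Ω') (Y : Ω' → ℝ) : ℝ≥0∞ :=
  classDist {h | ∃ B : Set ℝ, MeasurableSet B ∧ h = B.indicator (fun _ => 1)} P X Q Y

/-- Kolmogorov distance: indicators of the half-lines `(-∞, z]`. -/
def dKol (P : Measure Ω) (X : Ω → ℝ) (Q : Measure Ω') (Y : Ω' → ℝ) : ℝ≥0∞ :=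
  classDist {h | ∃ z : ℝ, h = (Iic z).indicator (fun _ => 1)} P X Q Y

end Distances

variable {Ω H : Type*} [MeasurableSpace Ω] [NormedAddCommGroup H] [InnerProductSpace ℝ H]

/-- `X = {X(h) : h ∈ H}` is a centered Gaussian family with `E[X(h) X(g)] = ⟨h, g⟩`. -/
structure IsIsonormal (X : H → Ω → ℝ) (P : Measure Ω) : Prop where
  isGaussianProcess : IsGaussianProcess X P
  mean_eq_zero : ∀ h, ∫ ω, X h ω ∂P = 0
  covariance_eq : ∀ h g, ∫ ω, X h ω * X g ω ∂P = inner ℝ h g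

/-- The pairs `(F, DF)` for `F = g(X(φ₁), …, X(φₙ))` a smooth cylindrical random variable, `g` smooth
with compact support, and `DF = ∑ᵢ ∂ᵢg(X(φ₁), …, X(φₙ)) φᵢ`. -/
def cylindricalGraph (X : H → Ω → ℝ) (P : Measure Ω) : Set (Lp ℝ 2 P × Lp H 2 P) :=
  {p | ∃ (n : ℕ) (g : (Fin n → ℝ) → ℝ) (φ : Fin n → H),
    1 ≤ n ∧ ContDiff ℝ (⊤ : ℕ∞) g ∧ HasCompactSupport g ∧
    (∀ᵐ ω ∂P, p.1 ω = g (fun j => X (φ j) ω)) ∧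
    (∀ᵐ ω ∂P, p.2 ω = ∑ i, fderiv ℝ g (fun j => X (φ j) ω) (Pi.single i 1) • φ i)}

/-- `U` is the Malliavin derivative of `F`: the pair `(F, U)` is a limit in `L²(Ω) × L²(Ω; H)` of
pairs `(Fₖ, DFₖ)` with `Fₖ` smooth cylindrical. (The operator is closable, so `U` is unique.) -/
def IsMalliavinDeriv (X : H → Ω → ℝ) (P : Measure Ω) (F : Lp ℝ 2 P) (U : Lp H 2 P) : Prop :=
  (F, U) ∈ closure (cylindricalGraph X P)

/-- The space `𝔻^{1,2}`, the closure of the smooth cylindrical random variables for the norm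
`(E[F²] + E‖DF‖²)^{1/2}`, i.e. the domain of the closed operator `D`. -/
def D12 (X : H → Ω → ℝ) (P : Measure Ω) : Set (Lp ℝ 2 P) :=
  {F | ∃ U, IsMalliavinDeriv X P F U}

open Classical in
/-- The Malliavin derivative `D`, as an operator from `𝔻^{1,2}` to `L²(Ω; H)` (with the value `0`
outside `𝔻^{1,2}`). -/
def D (X : H → Ω → ℝ) (P : Measure Ω) (F : Lp ℝ 2 P) : Lp H 2 P :=
  if hF : ∃ U, IsMalliavinDeriv X P F U then hF.choose else 0

/-- Generators of the `q`-th Wiener chaos: the constant `1` if `q = 0`, and the random variables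
`H_q(X(h))`, `‖h‖ = 1`, if `q ≥ 1`, with `H_q` the `q`-th (probabilists') Hermite polynomial. -/
def chaosGenerators (X : H → Ω → ℝ) (P : Measure Ω) : ℕ → Set (Lp ℝ 2 P)
  | 0 => {F | ∀ᵐ ω ∂P, F ω = 1}
  | q + 1 => {F | ∃ h : H, ‖h‖ = 1 ∧
      ∀ᵐ ω ∂P, F ω = Polynomial.aeval (X h ω) (Polynomial.hermite (q + 1))}

/-- The `q`-th Wiener chaos: the closed linear span in `L²` of its generators. -/
def chaos (X : H → Ω → ℝ) (P : Measure Ω) (q : ℕ) : Submodule ℝ (Lp ℝ 2 P) :=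
  (Submodule.span ℝ (chaosGenerators X P q)).topologicalClosure

instance chaosHasOrthogonalProjection (X : H → Ω → ℝ) (P : Measure Ω) (q : ℕ) :
    (chaos X P q).HasOrthogonalProjection := by
  unfold chaos
  infer_instance

/-- The orthogonal projection `J_q` of `L²` onto the `q`-th Wiener chaos. -/
def J (X : H → Ω → ℝ) (P : Measure Ω) (q : ℕ) (F : Lp ℝ 2 P) : Lp ℝ 2 P :=
  (chaos X P q).starProjection F

/-- The inverse of the Ornstein-Uhlenbeck generator: `L⁻¹F = ∑_{q ≥ 1} -(1/q) J_q F`, the (orthogonal,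
hence convergent) series being taken in `L²`. -/
def Linv (X : H → Ω → ℝ) (P : Measure Ω) (F : Lp ℝ 2 P) : Lp ℝ 2 P :=
  ∑' q : ℕ, (-(1 / ((q : ℝ) + 1))) • J X P (q + 1) F

/-- The quantity `E[(1 - ⟨DF, -DL⁻¹F⟩_H)²]^{1/2} ∈ [0, ∞]`. -/
def steinBound (X : H → Ω → ℝ) (P : Measure Ω) (F : Lp ℝ 2 P) : ℝ≥0∞ :=
  (∫⁻ ω, ENNReal.ofReal ((1 - inner ℝ (D X P F ω) (-(D X P (Linv X P F) ω))) ^ 2) ∂P) ^ (1 / 2 : ℝ)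

end Malliavin

end

/-! The proof joins Stein's equation to a Malliavin integration by parts. For a test function `h`,
solve f'(x) - x f(x) = h(x) - E h(Z) with f of class C¹ and |f'| ≤ 1. If V = -DL⁻¹F has divergence
F, meaning E⟨DS, V⟩ = E[S F] for every S in the domain of D, then S = f(F) and the chain rule give
E[F f(F)] = E[f'(F)⟨DF, V⟩]. Hence E h(F) - E h(Z) = E[f'(F)(1 - ⟨DF, V⟩)], and |f'| ≤ 1 bounds this
by the L¹ norm of 1 - ⟨DF, V⟩, which is at most its L² norm B(F).

The divergence property (`exists_isMalliavinDeriv_Linv`) is spectral. Gaussian integration by parts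
shows that the q-th chaos consists of weak eigenvectors of the Ornstein-Uhlenbeck operator for the
eigenvalue q (`chaos_le_eigenspace`). Different chaoses are therefore orthogonal, and the series for
L⁻¹F can be differentiated term by term, the eigenvalue cancelling the factor 1/q. What remains of F
after removing its chaos components is orthogonal to the domain of D
(`inner_eq_zero_of_orthogonal_chaos`), so no test variable S detects it.

The bound |f'| ≤ 1 (`exists_stein_solution_of_le`) is proved for 1-Lipschitz h, where it rests on a
sharp Gaussian tail estimate, and for continuous h with values in [0, 1]. The first case controls
d_W and thereby d_FM. The second controls d_TV, and thereby d_Kol, once indicators are approximated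
by continuous functions in L¹ of both laws. -/

namespace Malliavin

open Filter Topology

/-! ### Isonormal processes: almost sure linearity and independence -/

section Isonormal

variable {Ω H : Type*} [MeasurableSpace Ω] [NormedAddCommGroup H] [InnerProductSpace ℝ H]
  {X : H → Ω → ℝ} {P : Measure Ω}

theorem IsIsonormal.memLp (hX : IsIsonormal X P) (h : H) {p : ℝ≥0∞} (hp : p ≠ ∞) :
    MemLp (X h) p P :=
  (hX.isGaussianProcess.hasGaussianLaw_eval h).memLp hp

theorem IsIsonormal.aemeasurable (hX : IsIsonormal X P) (h : H) : AEMeasurable (X h) P :=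
  hX.isGaussianProcess.aemeasurable h

theorem IsIsonormal.aemeasurable_pi {ι : Type*} [Countable ι] (hX : IsIsonormal X P) (φ : ι → H) :
    AEMeasurable (fun ω i => X (φ i) ω) P :=
  aemeasurable_pi_lambda _ fun i => hX.aemeasurable (φ i)

/-- The isonormal process as a map into `L²`. -/
noncomputable def IsIsonormal.toL2 (hX : IsIsonormal X P) (h : H) : Lp ℝ 2 P :=
  (hX.memLp h (p := 2) (by simp)).toLp (X h)

theorem IsIsonormal.coeFn_toL2 (hX : IsIsonormal X P) (h : H) : hX.toL2 h =ᵐ[P] X h :=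
  MemLp.coeFn_toLp _

theorem IsIsonormal.inner_toL2 (hX : IsIsonormal X P) (h g : H) :
    inner ℝ (hX.toL2 h) (hX.toL2 g) = inner ℝ h g := by
  rw [L2.inner_def, ← hX.covariance_eq]
  refine integral_congr_ae ?_
  filter_upwards [hX.coeFn_toL2 h, hX.coeFn_toL2 g] with ω h1 h2
  simp [h1, h2, mul_comm]

/-- A map preserving inner products is automatically linear: the squared norm of the defect expands
to zero. The same argument gives homogeneity. -/
theorem IsIsonormal.toL2_add (hX : IsIsonormal X P) (h g : H) :
    hX.toL2 (h + g) = hX.toL2 h + hX.toL2 g := by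
  rw [← sub_eq_zero, ← inner_self_eq_zero (𝕜 := ℝ)]
  simp only [inner_sub_left, inner_sub_right, inner_add_left, inner_add_right, hX.inner_toL2]
  ring

theorem IsIsonormal.toL2_smul (hX : IsIsonormal X P) (c : ℝ) (h : H) :
    hX.toL2 (c • h) = c • hX.toL2 h := by
  rw [← sub_eq_zero, ← inner_self_eq_zero (𝕜 := ℝ)]
  simp only [inner_sub_left, inner_sub_right, inner_smul_left, inner_smul_right, hX.inner_toL2]
  simp

theorem IsIsonormal.ae_add (hX : IsIsonormal X P) (h g : H) :
    ∀ᵐ ω ∂P, X (h + g) ω = X h ω + X g ω := by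
  have := hX.toL2_add h g
  filter_upwards [hX.coeFn_toL2 (h + g), hX.coeFn_toL2 h, hX.coeFn_toL2 g,
    Lp.coeFn_add (hX.toL2 h) (hX.toL2 g)] with ω h1 h2 h3 h4
  rw [← h1, this, h4, Pi.add_apply, h2, h3]

theorem IsIsonormal.ae_smul (hX : IsIsonormal X P) (c : ℝ) (h : H) :
    ∀ᵐ ω ∂P, X (c • h) ω = c * X h ω := by
  have := hX.toL2_smul c h
  filter_upwards [hX.coeFn_toL2 (c • h), hX.coeFn_toL2 h,
    Lp.coeFn_smul c (hX.toL2 h)] with ω h1 h2 h3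
  rw [← h1, this, h3, Pi.smul_apply, h2, smul_eq_mul]

theorem IsIsonormal.ae_sum {ι : Type*} (s : Finset ι) (hX : IsIsonormal X P) (c : ι → ℝ)
    (φ : ι → H) : ∀ᵐ ω ∂P, X (∑ i ∈ s, c i • φ i) ω = ∑ i ∈ s, c i * X (φ i) ω := by
  classical
  induction s using Finset.induction_on with
  | empty =>
    -- The empty sum needs X(0) = 0 almost surely, which is homogeneity with the scalar 0.
    filter_upwards [hX.ae_smul 0 (0 : H)] with ω h
    simpa using h
  | insert a s ha ih =>
    filter_upwards [ih, hX.ae_smul (c a) (φ a), hX.ae_add (c a • φ a) (∑ i ∈ s, c i • φ i)]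
      with ω h1 h2 h3
    rw [Finset.sum_insert ha, Finset.sum_insert ha, h3, h2, h1]

theorem IsIsonormal.map_eq [IsProbabilityMeasure P] (hX : IsIsonormal X P) {h : H}
    (hh : ‖h‖ = 1) : P.map (X h) = gaussianReal 0 1 := by
  rw [(hX.isGaussianProcess.hasGaussianLaw_eval h).map_eq_gaussianReal, hX.mean_eq_zero,
    variance_of_integral_eq_zero (hX.aemeasurable h) (hX.mean_eq_zero h)]
  have : ∫ ω, X h ω ^ 2 ∂P = 1 := by
    simp_rw [pow_two, hX.covariance_eq, real_inner_self_eq_norm_sq, hh, one_pow]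
  simp [this]

/-- Jointly Gaussian families with vanishing cross-covariances are independent, and here the
covariances are inner products. -/
theorem IsIsonormal.indepFun [IsProbabilityMeasure P] {ι : Type*} (hX : IsIsonormal X P) {h : H}
    {ψ : ι → H} (hψ : ∀ i, inner ℝ (ψ i) h = 0) :
    IndepFun (fun ω i => X (ψ i) ω) (X h) P := by
  have hG : IsGaussianProcess (Sum.elim (fun i => X (ψ i)) (fun _ : Unit => X h)) P := by
    have e : Sum.elim (fun i => X (ψ i)) (fun _ : Unit => X h) =
        X ∘ Sum.elim ψ (fun _ : Unit => h) := by
      ext (i | i) <;> rfl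
    exact e ▸ hX.isGaussianProcess.comp_right _
  have := hG.indepFun_of_covariance_eq_zero (fun i => hX.aemeasurable _)
    (fun i => hX.aemeasurable _) (fun i _ => by
      rw [covariance_eq_sub (hX.memLp _ (by simp)) (hX.memLp _ (by simp)), hX.mean_eq_zero]
      simpa [hψ] using hX.covariance_eq (ψ i) h)
  exact this.comp measurable_id (measurable_pi_apply ())

end Isonormal

/-! ### Gaussian integration by parts -/

section IntegrationByParts

theorem hasDerivAt_gaussianPDFReal (x : ℝ) :
    HasDerivAt (gaussianPDFReal 0 1) (-x * gaussianPDFReal 0 1 x) x := by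
  have h1 : HasDerivAt (fun y : ℝ => -y ^ 2 / 2) (-x) x := by
    exact (((hasDerivAt_pow 2 x).fun_neg).div_const 2).congr_deriv (by ring)
  have := (h1.exp).const_mul ((√(2 * Real.pi))⁻¹)
  have e : gaussianPDFReal 0 1 = fun y => (√(2 * Real.pi))⁻¹ * Real.exp (-y ^ 2 / 2) := by
    ext y; simp [gaussianPDFReal]
  rw [e]
  exact this.congr_deriv (by ring)

theorem continuous_gaussianPDFReal : Continuous (gaussianPDFReal 0 1) :=
  continuous_iff_continuousAt.2 fun x => (hasDerivAt_gaussianPDFReal x).continuousAt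

theorem integrable_gaussianReal_iff {f : ℝ → ℝ} :
    Integrable f (gaussianReal 0 1) ↔ Integrable (fun x => gaussianPDFReal 0 1 x * f x) := by
  rw [gaussianReal_of_var_ne_zero _ one_ne_zero,
    integrable_withDensity_iff_integrable_smul' (measurable_gaussianPDF _ _)
      (ae_of_all _ fun _ => gaussianPDF_lt_top)]
  simp [toReal_gaussianPDF]

theorem integral_gaussianReal (f : ℝ → ℝ) :
    ∫ x, f x ∂(gaussianReal 0 1) = ∫ x, gaussianPDFReal 0 1 x * f x := by
  simp [integral_gaussianReal_eq_integral_smul (one_ne_zero (α := ℝ≥0))]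

/-- Against the Gaussian density the integrand is the exact derivative of density times v, and an
integrable function with integrable derivative has no boundary terms. -/
theorem integral_deriv_sub_mul_gaussianReal {v v' : ℝ → ℝ} (hv : ∀ z, HasDerivAt v (v' z) z)
    (hv1 : Integrable v (gaussianReal 0 1))
    (hv2 : Integrable (fun z => v' z - v z * z) (gaussianReal 0 1)) :
    ∫ z, (v' z - v z * z) ∂(gaussianReal 0 1) = 0 := by
  rw [integral_gaussianReal]
  refine integral_eq_zero_of_hasDerivAt_of_integrable (f := fun z => gaussianPDFReal 0 1 z * v z)
    (fun z => ?_) (integrable_gaussianReal_iff.1 hv2) (integrable_gaussianReal_iff.1 hv1)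
  exact ((hasDerivAt_gaussianPDFReal z).fun_mul (hv z)).congr_deriv (by ring)

variable {Ω H : Type*} [MeasurableSpace Ω] [NormedAddCommGroup H] [InnerProductSpace ℝ H]
  {X : H → Ω → ℝ} {P : Measure Ω} [IsProbabilityMeasure P]

/-- Gaussian integration by parts in the direction of a unit vector. -/
theorem IsIsonormal.integral_fderiv_eq {ι : Type*} [Fintype ι] (hX : IsIsonormal X P) {h : H}
    (hh : ‖h‖ = 1) (φ : ι → H) {G : (ι → ℝ) → ℝ} (hG : ContDiff ℝ 1 G)
    (h1 : Integrable (fun ω => G (fun i => X (φ i) ω)) P)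
    (h2 : Integrable (fun ω => fderiv ℝ G (fun i => X (φ i) ω) (fun i => inner ℝ (φ i) h)) P)
    (h3 : Integrable (fun ω => G (fun i => X (φ i) ω) * X h ω) P) :
    ∫ ω, fderiv ℝ G (fun i => X (φ i) ω) (fun i => inner ℝ (φ i) h) ∂P =
      ∫ ω, G (fun i => X (φ i) ω) * X h ω ∂P := by
  set c : ι → ℝ := fun i => inner ℝ (φ i) h with hc
  -- Remove the component along h. The remaining variables are independent of X(h), so conditionally
  -- on them the claim is the one-dimensional formula along the line with direction c.
  set ψ : ι → H := fun i => φ i - c i • h with hψ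
  have hψh : ∀ i, inner ℝ (ψ i) h = 0 := fun i => by
    simp [hψ, hc, inner_sub_left, inner_smul_left, hh]
  set W : Ω → ι → ℝ := fun ω i => X (ψ i) ω
  have hW : AEMeasurable W P := hX.aemeasurable_pi ψ
  have hdec : ∀ᵐ ω ∂P, (fun i => X (φ i) ω) = W ω + X h ω • c := by
    have : ∀ᵐ ω ∂P, ∀ i, X (φ i) ω = W ω i + X h ω * c i := by
      refine ae_all_iff.2 fun i => ?_
      filter_upwards [hX.ae_add (ψ i) (c i • h), hX.ae_smul (c i) h] with ω e1 e2
      have : ψ i + c i • h = φ i := by simp [hψ]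
      rw [this] at e1
      rw [e1, e2, mul_comm]
    filter_upwards [this] with ω hω
    ext i
    simp [hω i]
  set μ : Measure ((ι → ℝ) × ℝ) := (P.map W).prod (gaussianReal 0 1) with hμ
  have hlaw : P.map (fun ω => (W ω, X h ω)) = μ := by
    rw [(indepFun_iff_map_prod_eq_prod_map_map hW (hX.aemeasurable h)).1 (hX.indepFun hψh),
      hX.map_eq hh]
  have hpair : AEMeasurable (fun ω => (W ω, X h ω)) P := hW.prodMk (hX.aemeasurable h)
  have hGc : Continuous G := hG.continuous
  have hG'c : Continuous (fun x => fderiv ℝ G x c) := 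
    (hG.continuous_fderiv one_ne_zero).clm_apply continuous_const
  set K : (ι → ℝ) × ℝ → ℝ := fun p => G (p.1 + p.2 • c)
  set K' : (ι → ℝ) × ℝ → ℝ := fun p => fderiv ℝ G (p.1 + p.2 • c) c
  have hline : Continuous fun p : (ι → ℝ) × ℝ => p.1 + p.2 • c := by fun_prop
  have hK : Continuous K := hGc.comp hline
  have hK' : Continuous K' := hG'c.comp hline
  have i1 : Integrable K μ := by
    rw [← hlaw, integrable_map_measure hK.aestronglyMeasurable hpair]
    refine h1.congr ?_
    filter_upwards [hdec] with ω e
    simp [K, e]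
  have i2 : Integrable K' μ := by
    rw [← hlaw, integrable_map_measure hK'.aestronglyMeasurable hpair]
    refine h2.congr ?_
    filter_upwards [hdec] with ω e
    simp [K', e]
  have hK3 : Continuous fun p => K p * p.2 := hK.mul continuous_snd
  have i3 : Integrable (fun p => K p * p.2) μ := by
    rw [← hlaw, integrable_map_measure hK3.aestronglyMeasurable hpair]
    refine h3.congr ?_
    filter_upwards [hdec] with ω e
    simp [K, e]
  have e : ∫ p, (K' p - K p * p.2) ∂μ = 0 := by
    have hWp : IsProbabilityMeasure (P.map W) := Measure.isProbabilityMeasure_map hW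
    rw [hμ, integral_prod _ (by rw [← hμ]; exact i2.sub i3)]
    refine integral_eq_zero_of_ae ?_
    filter_upwards [i1.prod_right_ae, (i2.sub i3).prod_right_ae] with w j1 j2
    refine integral_deriv_sub_mul_gaussianReal (v := fun z => K (w, z)) (v' := fun z => K' (w, z))
      (fun z => ?_) j1 j2
    have hl : HasDerivAt (fun z : ℝ => w + z • c) c z := by
      simpa using ((hasDerivAt_id z).smul_const c).const_add w
    exact ((hG.differentiable one_ne_zero _).hasFDerivAt).comp_hasDerivAt z hl
  rw [← hlaw, integral_map hpair (by rw [hlaw]; exact (i2.sub i3).aestronglyMeasurable)] at e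
  rw [← sub_eq_zero, ← integral_sub h2 h3, ← e]
  refine integral_congr_ae ?_
  filter_upwards [hdec] with ω e
  simp [K, K', e]

/-- Gaussian integration by parts for a product of functions of the process. -/
theorem IsIsonormal.integral_fderiv_mul_eq {ι κ : Type*} [Fintype ι] [Fintype κ]
    (hX : IsIsonormal X P) {h : H} (hh : ‖h‖ = 1) (φ : ι → H) (ψ : κ → H) {g : (ι → ℝ) → ℝ}
    {k : (κ → ℝ) → ℝ} (hg : ContDiff ℝ 1 g) (hgc : HasCompactSupport g) (hk : ContDiff ℝ 1 k)
    (h1 : Integrable (fun ω => k (fun i => X (ψ i) ω)) P)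
    (h2 : Integrable (fun ω => fderiv ℝ k (fun i => X (ψ i) ω) (fun i => inner ℝ (ψ i) h)) P)
    (h3 : Integrable (fun ω => k (fun i => X (ψ i) ω) * X h ω) P) :
    ∫ ω, fderiv ℝ g (fun i => X (φ i) ω) (fun i => inner ℝ (φ i) h) *
        k (fun i => X (ψ i) ω) ∂P =
      ∫ ω, g (fun i => X (φ i) ω) * (k (fun i => X (ψ i) ω) * X h ω -
        fderiv ℝ k (fun i => X (ψ i) ω) (fun i => inner ℝ (ψ i) h)) ∂P := by
  -- The product is treated as a single function of the concatenated family; the claim is then the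
  -- Leibniz rule.
  let L : (ι ⊕ κ → ℝ) →L[ℝ] (ι → ℝ) := ContinuousLinearMap.pi fun i => .proj (Sum.inl i)
  let R : (ι ⊕ κ → ℝ) →L[ℝ] (κ → ℝ) := ContinuousLinearMap.pi fun i => .proj (Sum.inr i)
  have hgd := hg.differentiable one_ne_zero
  have hkd := hk.differentiable one_ne_zero
  have hd : ∀ x v, fderiv ℝ (fun x => g (L x) * k (R x)) x v =
      fderiv ℝ g (L x) (L v) * k (R x) + g (L x) * fderiv ℝ k (R x) (R v) := by
    intro x v
    have := (((hgd (L x)).hasFDerivAt).comp x L.hasFDerivAt).mul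
      (((hkd (R x)).hasFDerivAt).comp x R.hasFDerivAt)
    have e := this.fderiv
    change fderiv ℝ (fun x => g (L x) * k (R x)) x = _ at e
    rw [e]
    simp
    ring
  have hm : AEMeasurable (fun ω i => X (φ i) ω) P := hX.aemeasurable_pi φ
  have hmg : AEStronglyMeasurable (fun ω => g (fun i => X (φ i) ω)) P :=
    (hg.continuous.measurable.comp_aemeasurable hm).aestronglyMeasurable
  have hmg' : AEStronglyMeasurable
      (fun ω => fderiv ℝ g (fun i => X (φ i) ω) (fun i => inner ℝ (φ i) h)) P :=
    (((hg.continuous_fderiv one_ne_zero).clm_apply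
      continuous_const).measurable.comp_aemeasurable hm).aestronglyMeasurable
  obtain ⟨C, hC⟩ := hgc.exists_bound_of_continuous hg.continuous
  obtain ⟨C', hC'⟩ := (hgc.fderiv_apply ℝ (fun i => inner ℝ (φ i) h)).exists_bound_of_continuous
    ((hg.continuous_fderiv one_ne_zero).clm_apply continuous_const)
  have j1 : Integrable (fun ω => g (fun i => X (φ i) ω) * k (fun i => X (ψ i) ω)) P :=
    h1.bdd_mul hmg (ae_of_all _ fun ω => hC _)
  have j2 : Integrable (fun ω => fderiv ℝ g (fun i => X (φ i) ω) (fun i => inner ℝ (φ i) h) *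
      k (fun i => X (ψ i) ω)) P := h1.bdd_mul hmg' (ae_of_all _ fun ω => hC' _)
  have j3 : Integrable (fun ω => g (fun i => X (φ i) ω) *
      fderiv ℝ k (fun i => X (ψ i) ω) (fun i => inner ℝ (ψ i) h)) P :=
    h2.bdd_mul hmg (ae_of_all _ fun ω => hC _)
  have j4 : Integrable (fun ω => g (fun i => X (φ i) ω) * (k (fun i => X (ψ i) ω) * X h ω)) P :=
    h3.bdd_mul hmg (ae_of_all _ fun ω => hC _)
  have key := hX.integral_fderiv_eq hh (Sum.elim φ ψ) (G := fun x => g (L x) * k (R x))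
    ((hg.comp L.contDiff).mul (hk.comp R.contDiff)) j1
    (by simp only [hd]; exact j2.add j3)
    (j4.congr (ae_of_all _ fun ω => (mul_assoc _ _ _).symm))
  simp only [hd] at key
  have key' : ∫ ω, (fderiv ℝ g (fun i => X (φ i) ω) (fun i => inner ℝ (φ i) h) *
      k (fun i => X (ψ i) ω) + g (fun i => X (φ i) ω) *
      fderiv ℝ k (fun i => X (ψ i) ω) (fun i => inner ℝ (ψ i) h)) ∂P =
      ∫ ω, g (fun i => X (φ i) ω) * k (fun i => X (ψ i) ω) * X h ω ∂P := key
  rw [integral_add j2 j3] at key'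
  simp only [mul_sub]
  rw [integral_sub j4 j3, eq_sub_iff_add_eq, key']
  simp only [mul_assoc]

end IntegrationByParts

/-! ### Dominated convergence in L² -/

section Convergence

variable {Ω E : Type*} [MeasurableSpace Ω] [NormedAddCommGroup E] {P : Measure Ω}

theorem tendsto_toLp_of_dominated {f : ℕ → Ω → E} {g : Ω → E} {b : Ω → ℝ}
    (hf : ∀ n, MemLp (f n) 2 P) (hg : MemLp g 2 P) (hb : MemLp b 2 P)
    (hfb : ∀ n, ∀ᵐ ω ∂P, ‖f n ω‖ ≤ b ω)
    (hlim : ∀ᵐ ω ∂P, Tendsto (fun n => f n ω) atTop (𝓝 (g ω))) :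
    Tendsto (fun n => (hf n).toLp (f n)) atTop (𝓝 (hg.toLp g)) := by
  rw [Lp.tendsto_Lp_iff_tendsto_eLpNorm'']
  simp_rw [eLpNorm_eq_lintegral_rpow_enorm_toReal (two_ne_zero) (ENNReal.ofNat_ne_top),
    ENNReal.toReal_ofNat]
  have hgb : ∀ᵐ ω ∂P, ‖g ω‖ ≤ b ω := by
    filter_upwards [hlim, ae_all_iff.2 hfb] with ω h1 h2
    exact le_of_tendsto h1.norm (Eventually.of_forall h2)
  have hfin : ∫⁻ ω, ‖(2 * b ω : ℝ)‖ₑ ^ (2 : ℝ) ∂P ≠ ∞ := by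
    have := lintegral_rpow_enorm_lt_top_of_eLpNorm_lt_top two_ne_zero ENNReal.ofNat_ne_top
      (hb.const_mul 2).2
    simpa using this.ne
  have key : Tendsto (fun n => ∫⁻ ω, ‖(f n - g) ω‖ₑ ^ (2 : ℝ) ∂P) atTop
      (𝓝 (∫⁻ _, 0 ∂P)) := by
    refine tendsto_lintegral_of_dominated_convergence' (fun ω => ‖(2 * b ω : ℝ)‖ₑ ^ (2 : ℝ))
      (fun n => (((hf n).1.sub hg.1).enorm.pow_const _)) (fun n => ?_) hfin ?_
    · filter_upwards [hfb n, hgb] with ω h1 h2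
      gcongr
      rw [← ofReal_norm, ← ofReal_norm]
      refine ENNReal.ofReal_le_ofReal ?_
      calc ‖(f n - g) ω‖ ≤ ‖f n ω‖ + ‖g ω‖ := norm_sub_le _ _
        _ ≤ 2 * b ω := by linarith
        _ ≤ ‖2 * b ω‖ := Real.le_norm_self _
    · filter_upwards [hlim] with ω h
      have h0 : Tendsto (fun n => f n ω - g ω) atTop (𝓝 0) := by
        simpa using h.sub_const (g ω)
      have := (ENNReal.continuous_rpow_const (y := (2 : ℝ))).tendsto _ |>.comp h0.enorm
      simpa [Function.comp_def] using this
  have := (ENNReal.continuous_rpow_const (y := (1 / 2 : ℝ))).tendsto _ |>.comp key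
  simpa [Function.comp_def] using this

end Convergence

/-! ### Smooth cutoffs -/

section Cutoff

variable {ι : Type*} [Fintype ι]

/-- Smooth compactly supported functions increasing to one, with derivatives tending to zero. -/
theorem exists_smooth_cutoff (ι : Type*) [Fintype ι] : ∃ (χ : ℕ → (ι → ℝ) → ℝ) (C : ℝ),
    (∀ n, ContDiff ℝ (⊤ : ℕ∞) (χ n)) ∧ (∀ n, HasCompactSupport (χ n)) ∧
    (∀ n x, |χ n x| ≤ 1) ∧ (∀ n x, ‖fderiv ℝ (χ n) x‖ ≤ C) ∧
    (∀ x, Tendsto (fun n => χ n x) atTop (𝓝 1)) ∧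
    (∀ x, Tendsto (fun n => fderiv ℝ (χ n) x) atTop (𝓝 0)) := by
  let η : ContDiffBump (0 : ι → ℝ) := ⟨1, 2, one_pos, one_lt_two⟩
  have hη : ContDiff ℝ (⊤ : ℕ∞) η := η.contDiff
  obtain ⟨C, hC⟩ := (η.hasCompactSupport.fderiv (𝕜 := ℝ)).exists_bound_of_continuous
    (hη.continuous_fderiv (by simp))
  have hr : ∀ n : ℕ, ((n : ℝ) + 1)⁻¹ ≠ 0 := fun n => by positivity
  have hr1 : ∀ n : ℕ, ((n : ℝ) + 1)⁻¹ ≤ 1 := fun n => inv_le_one_of_one_le₀ (by simp)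
  have hlim : Tendsto (fun n : ℕ => ((n : ℝ) + 1)⁻¹) atTop (𝓝 0) := by
    simpa [one_div] using tendsto_one_div_add_atTop_nhds_zero_nat (𝕜 := ℝ)
  have hfd : ∀ (n : ℕ) (x : ι → ℝ), fderiv ℝ (fun x => η (((n : ℝ) + 1)⁻¹ • x)) x =
      ((n : ℝ) + 1)⁻¹ • fderiv ℝ η (((n : ℝ) + 1)⁻¹ • x) := fun n x => by
    have h1 : HasFDerivAt η (fderiv ℝ η (((n : ℝ) + 1)⁻¹ • x)) (((n : ℝ) + 1)⁻¹ • x) :=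
      (hη.differentiable (by simp) _).hasFDerivAt
    have h2 : HasFDerivAt (fun x : ι → ℝ => ((n : ℝ) + 1)⁻¹ • x)
        (((n : ℝ) + 1)⁻¹ • ContinuousLinearMap.id ℝ (ι → ℝ)) x :=
      (hasFDerivAt_id x).fun_const_smul _
    have := (h1.comp x h2).fderiv
    rw [Function.comp_def] at this
    rw [this]
    ext v
    simp
  have hC0 : 0 ≤ C := (norm_nonneg _).trans (hC 0)
  refine ⟨fun n x => η (((n : ℝ) + 1)⁻¹ • x), C, fun n => hη.comp (contDiff_const_smul _),
    fun n => η.hasCompactSupport.comp_smul (hr n), fun n x => ?_, fun n x => ?_, fun x => ?_,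
    fun x => ?_⟩
  · rw [abs_of_nonneg η.nonneg]
    exact η.le_one
  · rw [hfd, norm_smul, Real.norm_of_nonneg (by positivity)]
    calc _ ≤ 1 * C := by gcongr; exacts [hr1 n, hC _]
      _ = C := one_mul _
  · have h0 : Tendsto (fun n : ℕ => ((n : ℝ) + 1)⁻¹ • x) atTop (𝓝 0) := by
      simpa using hlim.smul_const x
    have := (hη.continuous.tendsto 0).comp h0
    have e : η 0 = 1 := η.one_of_mem_closedBall (by simp [η])
    rwa [e] at this
  · simp_rw [hfd]
    rw [tendsto_zero_iff_norm_tendsto_zero]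
    refine squeeze_zero (fun n => norm_nonneg _) (g := fun n : ℕ => ((n : ℝ) + 1)⁻¹ * C)
      (fun n => ?_) (by simpa using hlim.mul_const C)
    rw [norm_smul, Real.norm_of_nonneg (by positivity)]
    gcongr
    exact hC _

end Cutoff

/-! ### The graph of the Malliavin derivative, duality and closability -/

section Graph

variable {Ω H : Type*} [MeasurableSpace Ω] [NormedAddCommGroup H] [InnerProductSpace ℝ H]
  {X : H → Ω → ℝ} {P : Measure Ω}

open Classical in
/-- The linear map sending a linear form on `ℝ^ι` with coefficients `aᵢ` to `∑ aᵢ φᵢ`. -/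
noncomputable def gradMap {ι : Type*} [Fintype ι] (φ : ι → H) : ((ι → ℝ) →L[ℝ] ℝ) →L[ℝ] H :=
  ∑ i, (ContinuousLinearMap.apply ℝ ℝ (Pi.single i (1 : ℝ))).smulRight (φ i)

theorem gradMap_apply {ι : Type*} [Fintype ι] [DecidableEq ι] (φ : ι → H)
    (L : (ι → ℝ) →L[ℝ] ℝ) : gradMap φ L = ∑ i, L (Pi.single i 1) • φ i := by
  simp only [gradMap, sum_apply, ContinuousLinearMap.smulRight_apply,
    ContinuousLinearMap.apply_apply]
  congr!

/-- This turns ⟨DF, h⟩ into a directional derivative of g, the form used by the integration by parts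
formulas. -/
theorem inner_gradMap {ι : Type*} [Fintype ι] (φ : ι → H) (L : (ι → ℝ) →L[ℝ] ℝ) (h : H) :
    inner ℝ (gradMap φ L) h = L (fun i => inner ℝ (φ i) h) := by
  classical
  rw [gradMap_apply, sum_inner, ← L.coe_coe, LinearMap.pi_apply_eq_sum_univ L.toLinearMap]
  refine Finset.sum_congr rfl fun i _ => ?_
  rw [real_inner_smul_left, smul_eq_mul, mul_comm]
  congr 2
  ext j
  simp [Pi.single_apply, eq_comm]

theorem mem_cylindricalGraph_iff {p : Lp ℝ 2 P × Lp H 2 P} :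
    p ∈ cylindricalGraph X P ↔ ∃ (n : ℕ) (g : (Fin n → ℝ) → ℝ) (φ : Fin n → H),
      1 ≤ n ∧ ContDiff ℝ (⊤ : ℕ∞) g ∧ HasCompactSupport g ∧
      (∀ᵐ ω ∂P, p.1 ω = g (fun j => X (φ j) ω)) ∧
      (∀ᵐ ω ∂P, p.2 ω = gradMap φ (fderiv ℝ g (fun j => X (φ j) ω))) := by
  simp only [cylindricalGraph, gradMap_apply, mem_ofPred_eq]

/-- Multiply g by cutoffs. The gradients of the products are dominated by a multiple of ‖∇g‖ + C|g|,
which is square integrable, so values and gradients converge in L². -/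
theorem IsIsonormal.isMalliavinDeriv_fin (hX : IsIsonormal X P) {n : ℕ} (hn : 1 ≤ n)
    (φ : Fin n → H) {g : (Fin n → ℝ) → ℝ} (hg : ContDiff ℝ (⊤ : ℕ∞) g)
    (hg2 : MemLp (fun ω => fderiv ℝ g (fun i => X (φ i) ω)) 2 P) {F : Lp ℝ 2 P} {U : Lp H 2 P}
    (hF : ∀ᵐ ω ∂P, F ω = g (fun i => X (φ i) ω))
    (hU : ∀ᵐ ω ∂P, U ω = gradMap φ (fderiv ℝ g (fun i => X (φ i) ω))) :
    IsMalliavinDeriv X P F U := by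
  obtain ⟨χ, C, hχ, hχc, hχ1, hχC, hχlim, hχ'lim⟩ := exists_smooth_cutoff (Fin n)
  have hm : AEMeasurable (fun ω i => X (φ i) ω) P := hX.aemeasurable_pi φ
  have hg1 : MemLp (fun ω => g (fun i => X (φ i) ω)) 2 P := (Lp.memLp F).ae_eq hF
  set gk : ℕ → (Fin n → ℝ) → ℝ := fun k x => χ k x * g x with hgk
  have hgks : ∀ k, ContDiff ℝ (⊤ : ℕ∞) (gk k) := fun k => (hχ k).mul hg
  have hgkc : ∀ k, HasCompactSupport (gk k) := fun k => (hχc k).mul_right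
  have hd : ∀ k x, fderiv ℝ (gk k) x = χ k x • fderiv ℝ g x + g x • fderiv ℝ (χ k) x :=
    fun k x => fderiv_fun_mul ((hχ k).differentiable (by simp) x) (hg.differentiable (by simp) x)
  have m1 : ∀ k, AEStronglyMeasurable (fun ω => gk k (fun i => X (φ i) ω)) P := fun k =>
    ((hgks k).continuous.measurable.comp_aemeasurable hm).aestronglyMeasurable
  have m2 : ∀ k, AEStronglyMeasurable
      (fun ω => gradMap φ (fderiv ℝ (gk k) (fun i => X (φ i) ω))) P := fun k =>
    ((gradMap φ).continuous.comp ((hgks k).continuous_fderiv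
      (by simp))).comp_aestronglyMeasurable hm.aestronglyMeasurable
  have b1 : ∀ k, ∀ ω, ‖gk k (fun i => X (φ i) ω)‖ ≤ ‖g (fun i => X (φ i) ω)‖ := fun k ω => by
    rw [hgk, norm_mul]
    exact mul_le_of_le_one_left (norm_nonneg _) (hχ1 _ _)
  have b2 : ∀ k, ∀ ω, ‖gradMap φ (fderiv ℝ (gk k) (fun i => X (φ i) ω))‖ ≤
      ‖gradMap φ‖ * (‖fderiv ℝ g (fun i => X (φ i) ω)‖ + C * ‖g (fun i => X (φ i) ω)‖) := by
    intro k ω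
    refine ((gradMap φ).le_opNorm _).trans ?_
    gcongr
    rw [hd]
    refine (norm_add_le _ _).trans ?_
    rw [norm_smul, norm_smul]
    refine add_le_add ?_ ?_
    · exact mul_le_of_le_one_left (norm_nonneg _) (hχ1 _ _)
    · rw [mul_comm]
      exact mul_le_mul_of_nonneg_right (hχC _ _) (norm_nonneg _)
  have l1 : ∀ k, MemLp (fun ω => gk k (fun i => X (φ i) ω)) 2 P := fun k =>
    hg1.mono (m1 k) (ae_of_all _ (b1 k))
  have hB : MemLp (fun ω => ‖gradMap φ‖ * (‖fderiv ℝ g (fun i => X (φ i) ω)‖ +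
      C * ‖g (fun i => X (φ i) ω)‖)) 2 P := (hg2.norm.add (hg1.norm.const_mul C)).const_mul _
  have l2 : ∀ k, MemLp (fun ω => gradMap φ (fderiv ℝ (gk k) (fun i => X (φ i) ω))) 2 P :=
    fun k => hB.of_le (m2 k) (ae_of_all _ fun ω => (b2 k ω).trans (Real.le_norm_self _))
  have l2' : MemLp (fun ω => gradMap φ (fderiv ℝ g (fun i => X (φ i) ω))) 2 P :=
    (Lp.memLp U).ae_eq hU
  have t1 := tendsto_toLp_of_dominated l1 hg1 hg1.norm (fun k => ae_of_all _ (b1 k))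
    (ae_of_all _ fun ω => by
      simpa using (hχlim (fun i => X (φ i) ω)).mul_const (g (fun i => X (φ i) ω)))
  have t2 := tendsto_toLp_of_dominated l2 l2' hB (fun k => ae_of_all _ (b2 k))
    (ae_of_all _ fun ω => by
      refine ((gradMap φ).continuous.tendsto _).comp ?_
      simp_rw [hd]
      simpa using ((hχlim (fun i => X (φ i) ω)).smul_const
        (fderiv ℝ g (fun i => X (φ i) ω))).add
        ((hχ'lim (fun i => X (φ i) ω)).const_smul (g (fun i => X (φ i) ω))))
  have eF : hg1.toLp _ = F := Lp.ext ((MemLp.coeFn_toLp hg1).trans (by symm; exact hF))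
  have eU : l2'.toLp _ = U := Lp.ext ((MemLp.coeFn_toLp l2').trans (by symm; exact hU))
  rw [eF] at t1
  rw [eU] at t2
  refine mem_closure_of_tendsto (t1.prodMk_nhds t2) (Eventually.of_forall fun k => ?_)
  exact mem_cylindricalGraph_iff.2 ⟨n, gk k, φ, hn, hgks k, hgkc k, MemLp.coeFn_toLp (l1 k),
    MemLp.coeFn_toLp (l2 k)⟩

/-- A smooth function of finitely many `X(φᵢ)` which is square integrable together with its gradient
is in the domain of the Malliavin derivative. -/
theorem IsIsonormal.isMalliavinDeriv_of_contDiff {ι : Type*} [Fintype ι] [Nonempty ι]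
    (hX : IsIsonormal X P) (φ : ι → H) {g : (ι → ℝ) → ℝ} (hg : ContDiff ℝ (⊤ : ℕ∞) g)
    (hg2 : MemLp (fun ω => fderiv ℝ g (fun i => X (φ i) ω)) 2 P) {F : Lp ℝ 2 P} {U : Lp H 2 P}
    (hF : ∀ᵐ ω ∂P, F ω = g (fun i => X (φ i) ω))
    (hU : ∀ᵐ ω ∂P, U ω = gradMap φ (fderiv ℝ g (fun i => X (φ i) ω))) :
    IsMalliavinDeriv X P F U := by
  classical
  let e := Fintype.equivFin ι
  let A : (Fin (Fintype.card ι) → ℝ) →L[ℝ] (ι → ℝ) :=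
    ContinuousLinearMap.pi fun i => .proj (e i)
  have hA : ∀ ω, A (fun i => X (φ (e.symm i)) ω) = fun i => X (φ i) ω := fun ω => by
    ext i; simp [A]
  have hd : ∀ x, fderiv ℝ (fun x => g (A x)) x = (fderiv ℝ g (A x)).comp A := fun x =>
    (((hg.differentiable (by simp) (A x)).hasFDerivAt).comp x A.hasFDerivAt).fderiv
  have hgrad : ∀ L : (ι → ℝ) →L[ℝ] ℝ,
      gradMap (fun i => φ (e.symm i)) (L.comp A) = gradMap φ L := fun L => by
    rw [gradMap_apply, gradMap_apply, ← e.symm.sum_comp]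
    refine Finset.sum_congr rfl fun i _ => ?_
    have : A (Pi.single i 1) = Pi.single (e.symm i) 1 := by
      ext j
      simp [A, Pi.single_apply, Equiv.eq_symm_apply]
    simp [this]
  refine hX.isMalliavinDeriv_fin (g := fun x => g (A x)) Fintype.card_pos
    (fun i => φ (e.symm i)) (hg.comp A.contDiff) ?_ ?_ ?_
  · simp only [hd, hA]
    exact (ContinuousLinearMap.precomp ℝ A).comp_memLp' hg2
  · simpa only [hA] using hF
  · simpa only [hd, hA, hgrad] using hU

theorem IsMalliavinDeriv.zero : IsMalliavinDeriv X P (0 : Lp ℝ 2 P) (0 : Lp H 2 P) := by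
  refine subset_closure (mem_cylindricalGraph_iff.2 ⟨1, 0, 0, le_rfl, contDiff_const, ?_, ?_, ?_⟩)
  · exact HasCompactSupport.zero
  · exact Lp.coeFn_zero ℝ 2 P
  · filter_upwards [Lp.coeFn_zero H 2 P] with ω h
    simpa only [Pi.zero_apply, fderiv_zero, map_zero] using h

theorem IsMalliavinDeriv.smul {F : Lp ℝ 2 P} {U : Lp H 2 P} (hFU : IsMalliavinDeriv X P F U)
    (c : ℝ) : IsMalliavinDeriv X P (c • F) (c • U) := by
  refine map_mem_closure (f := fun p : Lp ℝ 2 P × Lp H 2 P => c • p) (continuous_const_smul c)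
    hFU ?_
  rintro ⟨F, U⟩ h
  obtain ⟨n, g, φ, hn, hg, hgc, h1, h2⟩ := mem_cylindricalGraph_iff.1 h
  refine mem_cylindricalGraph_iff.2 ⟨n, fun x => c * g x, φ, hn, contDiff_const.mul hg,
    hgc.mul_left, ?_, ?_⟩
  · filter_upwards [h1, Lp.coeFn_smul c F] with ω e1 e2
    simp only [Prod.smul_mk, e2, Pi.smul_apply, smul_eq_mul]
    rw [← e1]
  · filter_upwards [h2, Lp.coeFn_smul c U] with ω e1 e2
    simp only [Prod.smul_mk, e2, Pi.smul_apply]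
    rw [fderiv_const_mul (hg.differentiable (by simp) _), map_smul, ← e1]

variable [IsProbabilityMeasure P]

theorem IsIsonormal.memLp_of_hasCompactSupport {ι E : Type*} [Fintype ι] [NormedAddCommGroup E]
    (hX : IsIsonormal X P) (φ : ι → H) {g : (ι → ℝ) → E} (hg : Continuous g)
    (hgc : HasCompactSupport g) (p : ℝ≥0∞) : MemLp (fun ω => g (fun i => X (φ i) ω)) p P := by
  obtain ⟨C, hC⟩ := hgc.exists_bound_of_continuous hg
  exact MemLp.of_bound
    (hg.comp_aestronglyMeasurable (hX.aemeasurable_pi φ).aestronglyMeasurable) C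
    (ae_of_all _ fun ω => hC _)

/-- Cylindrical pairs are not visibly stable under sums: g(x) + k(y) has no compact support in (x,
y) in general. The sum of two such pairs is therefore placed only in the closure, which suffices
because closing twice adds nothing. -/
theorem IsMalliavinDeriv.add (hX : IsIsonormal X P) {F G : Lp ℝ 2 P} {U V : Lp H 2 P}
    (hFU : IsMalliavinDeriv X P F U) (hGV : IsMalliavinDeriv X P G V) :
    IsMalliavinDeriv X P (F + G) (U + V) := by
  have := map_mem_closure₂ (f := fun p q : Lp ℝ 2 P × Lp H 2 P => p + q) continuous_add
    (u := closure (cylindricalGraph X P)) hFU hGV ?_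
  · rwa [closure_closure] at this
  rintro ⟨F, U⟩ hF ⟨G, V⟩ hG
  obtain ⟨n, g, φ, hn, hg, hgc, h1, h2⟩ := mem_cylindricalGraph_iff.1 hF
  obtain ⟨m, k, ψ, hm, hk, hkc, h3, h4⟩ := mem_cylindricalGraph_iff.1 hG
  let L : (Fin n ⊕ Fin m → ℝ) →L[ℝ] (Fin n → ℝ) :=
    ContinuousLinearMap.pi fun i => .proj (Sum.inl i)
  let R : (Fin n ⊕ Fin m → ℝ) →L[ℝ] (Fin m → ℝ) :=
    ContinuousLinearMap.pi fun i => .proj (Sum.inr i)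
  have : Nonempty (Fin n ⊕ Fin m) := ⟨Sum.inl ⟨0, hn⟩⟩
  have hd : ∀ x, fderiv ℝ (fun x => g (L x) + k (R x)) x =
      (fderiv ℝ g (L x)).comp L + (fderiv ℝ k (R x)).comp R := fun x =>
    ((((hg.differentiable (by simp) (L x)).hasFDerivAt).comp x L.hasFDerivAt).add
      (((hk.differentiable (by simp) (R x)).hasFDerivAt).comp x R.hasFDerivAt)).fderiv
  have hL : ∀ ω, L (fun i => X (Sum.elim φ ψ i) ω) = fun i => X (φ i) ω := fun ω => rfl
  have hR : ∀ ω, R (fun i => X (Sum.elim φ ψ i) ω) = fun i => X (ψ i) ω := fun ω => rfl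
  have hgrad : ∀ a b, gradMap (Sum.elim φ ψ) (a.comp L + b.comp R) =
      gradMap φ a + gradMap ψ b := fun a b => by
    rw [gradMap_apply, gradMap_apply, gradMap_apply, Fintype.sum_sum_type]
    congr 1
    · refine Finset.sum_congr rfl fun i _ => ?_
      have e1 : L (Pi.single (Sum.inl i) 1) = Pi.single i 1 := by
        ext j; simp [L, Pi.single_apply]
      have e2 : R (Pi.single (Sum.inl i) 1) = 0 := by
        ext j; simp [R]
      simp [e1, e2]
    · refine Finset.sum_congr rfl fun i _ => ?_
      have e1 : R (Pi.single (Sum.inr i) 1) = Pi.single i 1 := by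
        ext j; simp [R, Pi.single_apply]
      have e2 : L (Pi.single (Sum.inr i) 1) = 0 := by
        ext j; simp [L]
      simp [e1, e2]
  have p1 : MemLp (fun ω => fderiv ℝ g (fun i => X (φ i) ω)) 2 P :=
    hX.memLp_of_hasCompactSupport φ (hg.continuous_fderiv (by simp)) (hgc.fderiv (𝕜 := ℝ)) 2
  have p2 : MemLp (fun ω => fderiv ℝ k (fun i => X (ψ i) ω)) 2 P :=
    hX.memLp_of_hasCompactSupport ψ (hk.continuous_fderiv (by simp)) (hkc.fderiv (𝕜 := ℝ)) 2
  have q1 : MemLp (fun ω => (fderiv ℝ g (fun i => X (φ i) ω)).comp L) 2 P :=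
    p1.of_le_mul (c := ‖L‖) ((ContinuousLinearMap.precomp ℝ L).continuous.comp_aestronglyMeasurable
      p1.1) (ae_of_all _ fun ω => by
        rw [mul_comm]
        exact ContinuousLinearMap.opNorm_comp_le _ _)
  have q2 : MemLp (fun ω => (fderiv ℝ k (fun i => X (ψ i) ω)).comp R) 2 P :=
    p2.of_le_mul (c := ‖R‖) ((ContinuousLinearMap.precomp ℝ R).continuous.comp_aestronglyMeasurable
      p2.1) (ae_of_all _ fun ω => by
        rw [mul_comm]
        exact ContinuousLinearMap.opNorm_comp_le _ _)
  refine hX.isMalliavinDeriv_of_contDiff (Sum.elim φ ψ) (g := fun x => g (L x) + k (R x))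
    ((hg.comp L.contDiff).add (hk.comp R.contDiff)) ?_ ?_ ?_
  · simp only [hd]
    exact (q1.norm.add q2.norm).of_le (q1.1.add q2.1) (ae_of_all _ fun ω =>
      (norm_add_le _ _).trans (Real.le_norm_self _))
  · simp only [hL, hR]
    filter_upwards [h1, h3, Lp.coeFn_add F G] with ω e1 e2 e3
    rw [e3, Pi.add_apply, ← e1, ← e2]
  · simp only [hd, hL, hR, hgrad]
    filter_upwards [h2, h4, Lp.coeFn_add U V] with ω e1 e2 e3
    rw [e3, Pi.add_apply, ← e1, ← e2]

/-- The graph of the Malliavin derivative as a subspace. -/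
noncomputable def derivGraph (hX : IsIsonormal X P) : Submodule ℝ (Lp ℝ 2 P × Lp H 2 P) where
  carrier := {p | IsMalliavinDeriv X P p.1 p.2}
  zero_mem' := IsMalliavinDeriv.zero
  add_mem' h1 h2 := IsMalliavinDeriv.add hX h1 h2
  smul_mem' c _ h := h.smul c

theorem mem_derivGraph {hX : IsIsonormal X P} {F : Lp ℝ 2 P} {U : Lp H 2 P} :
    (F, U) ∈ derivGraph hX ↔ IsMalliavinDeriv X P F U := Iff.rfl

theorem isClosed_derivGraph (hX : IsIsonormal X P) :
    IsClosed (derivGraph hX : Set (Lp ℝ 2 P × Lp H 2 P)) :=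
  isClosed_closure (s := cylindricalGraph X P)

/-- Duality between the Malliavin derivative and the divergence of `k(X(ψ)) h`. -/
theorem IsMalliavinDeriv.inner_eq {κ : Type*} [Fintype κ] (hX : IsIsonormal X P)
    {S : Lp ℝ 2 P} {W : Lp H 2 P} (hSW : IsMalliavinDeriv X P S W) {h : H} (hh : ‖h‖ = 1)
    (ψ : κ → H) {k : (κ → ℝ) → ℝ} (hk : ContDiff ℝ 1 k) {V : Lp H 2 P} {M : Lp ℝ 2 P}
    (hV : ∀ᵐ ω ∂P, V ω = k (fun i => X (ψ i) ω) • h)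
    (hM : ∀ᵐ ω ∂P, M ω = k (fun i => X (ψ i) ω) * X h ω -
      fderiv ℝ k (fun i => X (ψ i) ω) (fun i => inner ℝ (ψ i) h)) :
    inner ℝ W V = inner ℝ S M := by
  -- Pairing V with the unit vector h recovers k. Integrability of its derivative then comes from M,
  -- as a difference.
  have hkL : MemLp (fun ω => k (fun i => X (ψ i) ω)) 2 P := by
    refine ((Lp.memLp V).inner_const h).ae_eq ?_
    filter_upwards [hV] with ω e
    simp [e, inner_smul_left, hh]
  have h1 := hkL.integrable one_le_two
  have h3 : Integrable (fun ω => k (fun i => X (ψ i) ω) * X h ω) P :=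
    hkL.integrable_mul (hX.memLp h (p := 2) (by simp))
  have h2 : Integrable (fun ω => fderiv ℝ k (fun i => X (ψ i) ω) (fun i => inner ℝ (ψ i) h)) P := by
    refine (h3.sub ((Lp.memLp M).integrable one_le_two)).congr ?_
    filter_upwards [hM] with ω e
    simp [e]
  suffices closure (cylindricalGraph X P) ⊆
      {p : Lp ℝ 2 P × Lp H 2 P | inner ℝ p.2 V = inner ℝ p.1 M} from this hSW
  refine closure_minimal ?_ (isClosed_eq (by fun_prop) (by fun_prop))
  rintro ⟨S, W⟩ hSW
  obtain ⟨n, g, φ, hn, hg, hgc, e1, e2⟩ := mem_cylindricalGraph_iff.1 hSW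
  have key := hX.integral_fderiv_mul_eq hh φ ψ (hg.of_le (by simp)) hgc hk h1 h2 h3
  simp only [mem_ofPred_eq, L2.inner_def]
  convert key using 1
  · refine integral_congr_ae ?_
    filter_upwards [e2, hV] with ω a b
    rw [a, b, inner_smul_right, inner_gradMap, mul_comm]
  · refine integral_congr_ae ?_
    filter_upwards [e1, hM] with ω a b
    simp only [a, b]
    simp [mul_comm]

/-- The Malliavin derivative is closable. -/
theorem IsMalliavinDeriv.eq_zero [TopologicalSpace.SeparableSpace H] (hX : IsIsonormal X P)
    {U : Lp H 2 P} (hU : IsMalliavinDeriv X P 0 U) : U = 0 := by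
  have key : ∀ h : H, ‖h‖ = 1 → ∀ᵐ ω ∂P, inner ℝ h (U ω) = 0 := by
    intro h hh
    let T : H →L[ℝ] H := (innerSL ℝ h).smulRight h
    have hT : ∀ W : Lp H 2 P, (T.compLpL 2 P W : Lp H 2 P) =ᵐ[P] fun ω => inner ℝ h (W ω) • h :=
      fun W => T.coeFn_compLpL W
    -- For cylindrical W, the field ⟨h, W⟩h has the form k(X(φ))h with k a directional derivative of
    -- g, so duality for the pair (0, U) makes it orthogonal to U. By closure this holds for W = U
    -- as well, and then E⟨h, U⟩² = 0.
    have hz : closure (cylindricalGraph X P) ⊆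
        {p : Lp ℝ 2 P × Lp H 2 P | inner ℝ U (T.compLpL 2 P p.2) = 0} := by
      refine closure_minimal ?_ (isClosed_eq (by fun_prop) (by fun_prop))
      rintro ⟨S, W⟩ hSW
      obtain ⟨n, g, φ, hn, hg, hgc, e1, e2⟩ := mem_cylindricalGraph_iff.1 hSW
      set c : Fin n → ℝ := fun i => inner ℝ (φ i) h
      set k : (Fin n → ℝ) → ℝ := fun x => fderiv ℝ g x c
      have hk : ContDiff ℝ 1 k :=
        (hg.fderiv_right (m := 1) (WithTop.coe_le_coe.2 le_top)).clm_apply contDiff_const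
      have hkc : HasCompactSupport k := hgc.fderiv_apply ℝ c
      have hM : MemLp (fun ω => k (fun i => X (φ i) ω) * X h ω -
          fderiv ℝ k (fun i => X (φ i) ω) c) 2 P := by
        refine MemLp.sub ?_ (hX.memLp_of_hasCompactSupport φ
          ((hk.continuous_fderiv one_ne_zero).clm_apply continuous_const)
          (hkc.fderiv_apply ℝ c) 2)
        exact MemLp.mul (p := ∞) (q := 2) (hX.memLp h (p := 2) (by simp))
          (hX.memLp_of_hasCompactSupport φ hk.continuous hkc ∞)
      have := hU.inner_eq hX hh φ hk (V := T.compLpL 2 P W) (M := hM.toLp _) ?_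
        (MemLp.coeFn_toLp hM)
      · simpa using this
      filter_upwards [hT W, e2] with ω a b
      rw [a, b, real_inner_comm, inner_gradMap]
    have h0 : inner ℝ U (T.compLpL 2 P U) = (0 : ℝ) := hz hU
    rw [L2.inner_def] at h0
    have h1 : ∫ ω, inner ℝ h (U ω) ^ 2 ∂P = 0 := by
      rw [← h0]
      refine integral_congr_ae ?_
      filter_upwards [hT U] with ω a
      rw [a, inner_smul_right, real_inner_comm, pow_two]
    rw [integral_eq_zero_iff_of_nonneg (fun ω => sq_nonneg _)
      ((Lp.memLp U).const_inner h).integrable_sq] at h1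
    filter_upwards [h1] with ω a
    simpa using a
  refine Lp.eq_zero_iff_ae_eq_zero.2 ?_
  -- Separability allows the null set, which depends on the tested vector, to be chosen uniformly.
  have : SecondCountableTopology H := UniformSpace.secondCountable_of_separable H
  refine ae_eq_zero_of_forall_inner (𝕜 := ℝ) fun c => ?_
  rcases eq_or_ne c 0 with rfl | hc
  · exact ae_of_all _ fun ω => inner_zero_left _
  filter_upwards [key (‖c‖⁻¹ • c) (by simp [norm_smul, hc])] with ω a
  simpa [inner_smul_left, hc] using a

theorem IsMalliavinDeriv.unique [TopologicalSpace.SeparableSpace H] (hX : IsIsonormal X P)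
    {F : Lp ℝ 2 P} {U V : Lp H 2 P} (hU : IsMalliavinDeriv X P F U)
    (hV : IsMalliavinDeriv X P F V) : U = V := by
  have := (derivGraph hX).sub_mem (mem_derivGraph.2 hU) (mem_derivGraph.2 hV)
  rw [Prod.mk_sub_mk, sub_self, mem_derivGraph] at this
  exact sub_eq_zero.1 (this.eq_zero hX)

theorem IsMalliavinDeriv.D_eq [TopologicalSpace.SeparableSpace H] (hX : IsIsonormal X P)
    {F : Lp ℝ 2 P} {U : Lp H 2 P} (hU : IsMalliavinDeriv X P F U) : D X P F = U := by
  have h : ∃ U, IsMalliavinDeriv X P F U := ⟨U, hU⟩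
  rw [D, dif_pos h]
  exact h.choose_spec.unique hX hU

end Graph

/-! ### Orthogonal series in a Hilbert space -/

section Orthogonal

variable {E : Type*} [NormedAddCommGroup E] [InnerProductSpace ℝ E]

theorem summable_of_pairwise_orthogonal [CompleteSpace E] {v : ℕ → E}
    (hv : Pairwise fun i j => inner ℝ (v i) (v j) = 0) (hs : Summable fun i => ‖v i‖ ^ 2) :
    Summable v := by
  have hV : OrthogonalFamily ℝ (fun i => (ℝ ∙ v i : Submodule ℝ E))
      fun i => (ℝ ∙ v i : Submodule ℝ E).subtypeₗᵢ := by
    intro i j hij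
    rintro ⟨x, hx⟩ ⟨y, hy⟩
    obtain ⟨a, rfl⟩ := Submodule.mem_span_singleton.1 hx
    obtain ⟨b, rfl⟩ := Submodule.mem_span_singleton.1 hy
    simp [inner_smul_left, inner_smul_right, hv hij]
  exact (hV.summable_iff_norm_sq_summable
    (fun i => ⟨v i, Submodule.mem_span_singleton_self _⟩)).2 hs

theorem norm_sum_sq_of_pairwise_orthogonal {v : ℕ → E}
    (hv : Pairwise fun i j => inner ℝ (v i) (v j) = 0) (s : Finset ℕ) :
    ‖∑ i ∈ s, v i‖ ^ 2 = ∑ i ∈ s, ‖v i‖ ^ 2 := by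
  rw [← real_inner_self_eq_norm_sq, sum_inner]
  refine Finset.sum_congr rfl fun i hi => ?_
  rw [inner_sum, Finset.sum_eq_single_of_mem i hi fun j _ hj => hv hj.symm,
    real_inner_self_eq_norm_sq]

/-- Bessel's inequality, read off from ‖x - ∑ vᵢ‖² ≥ 0. -/
theorem summable_norm_sq_of_inner_eq {v : ℕ → E} {x : E}
    (hv : Pairwise fun i j => inner ℝ (v i) (v j) = 0) (hx : ∀ i, inner ℝ x (v i) = ‖v i‖ ^ 2) :
    Summable fun i => ‖v i‖ ^ 2 := by
  refine summable_of_sum_le (c := ‖x‖ ^ 2) (fun i => by positivity) fun s => ?_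
  have h1 := norm_sum_sq_of_pairwise_orthogonal hv s
  have h2 := norm_sub_sq_real x (∑ i ∈ s, v i)
  simp only [inner_sum, hx] at h2
  nlinarith [sq_nonneg ‖x - ∑ i ∈ s, v i‖]

end Orthogonal

/-! ### Hermite polynomials -/

section Hermite

open Polynomial

/-- The probabilists' Hermite polynomials with real coefficients. -/
noncomputable def hermiteReal (n : ℕ) : ℝ[X] := (hermite n).map (algebraMap ℤ ℝ)

theorem aeval_hermite_eq (n : ℕ) (x : ℝ) : aeval x (hermite n) = (hermiteReal n).eval x := by
  rw [hermiteReal, aeval_def, eval₂_eq_eval_map]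

theorem hermiteReal_zero : hermiteReal 0 = 1 := by simp [hermiteReal]

theorem hermiteReal_succ (n : ℕ) :
    hermiteReal (n + 1) = X * hermiteReal n - derivative (hermiteReal n) := by
  simp [hermiteReal, hermite_succ, derivative_map]

/-- Combined with the recursion, this gives x p - p' = (n + 1) Hₙ₊₁ for p = Hₙ₊₁', which is the
source of the eigenvalues. -/
theorem derivative_hermiteReal_succ (n : ℕ) :
    derivative (hermiteReal (n + 1)) = ((n : ℝ[X]) + 1) * hermiteReal n := by
  induction n with
  | zero => simp [hermiteReal_succ, hermiteReal_zero]
  | succ n ih =>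
    have h1 := hermiteReal_succ n
    rw [hermiteReal_succ (n + 1), derivative_sub, derivative_mul, ih]
    simp only [derivative_X, derivative_mul, derivative_add, derivative_natCast, derivative_one]
    push_cast
    linear_combination (-(n : ℝ[X]) - 1) * h1

theorem span_hermiteReal : Submodule.span ℝ (range hermiteReal) = ⊤ := by
  let S : Polynomial.Sequence ℝ :=
    ⟨hermiteReal, fun i => by
      rw [hermiteReal, degree_map_eq_of_injective (algebraMap ℤ ℝ).injective_int, degree_hermite]⟩
  exact S.span fun i => by
    change IsUnit (hermiteReal i).leadingCoeff
    rw [hermiteReal, ((hermite_monic i).map _).leadingCoeff]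
    exact isUnit_one

end Hermite

/-! ### Exponential and polynomial moments -/

section Moments

variable {Ω H : Type*} [MeasurableSpace Ω] [NormedAddCommGroup H] [InnerProductSpace ℝ H]
  {X : H → Ω → ℝ} {P : Measure Ω}

theorem IsIsonormal.integrable_exp_mul (hX : IsIsonormal X P) (h : H) (t : ℝ) :
    Integrable (fun ω => Real.exp (t * X h ω)) P := by
  have := integrable_exp_mul_gaussianReal (μ := ∫ ω, X h ω ∂P)
    (v := (variance (X h) P).toNNReal) t
  rw [← (hX.isGaussianProcess.hasGaussianLaw_eval h).map_eq_gaussianReal] at this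
  exact this.comp_aemeasurable (hX.aemeasurable h)

/-- The square exp(2|x|) is at most exp(2x) + exp(-2x), and Gaussian exponential moments are finite.
-/
theorem IsIsonormal.memLp_exp_abs (hX : IsIsonormal X P) (h : H) :
    MemLp (fun ω => Real.exp |X h ω|) 2 P := by
  have hm : AEStronglyMeasurable (fun ω => Real.exp |X h ω|) P :=
    ((Real.continuous_exp.comp continuous_abs).measurable.comp_aemeasurable
      (hX.aemeasurable h)).aestronglyMeasurable
  rw [memLp_two_iff_integrable_sq hm]
  refine ((hX.integrable_exp_mul h 2).add (hX.integrable_exp_mul h (-2))).mono' (hm.pow 2)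
    (ae_of_all _ fun ω => ?_)
  rw [Real.norm_of_nonneg (by positivity), ← Real.exp_nat_mul, Pi.add_apply]
  rcases abs_cases (X h ω) with ⟨e, _⟩ | ⟨e, _⟩ <;> rw [e]
  · exact le_add_of_nonneg_right (Real.exp_pos _).le
  · refine le_add_of_nonneg_of_le (Real.exp_pos _).le (le_of_eq ?_)
    congr 1
    push_cast
    ring

theorem IsIsonormal.memLp_pow (hX : IsIsonormal X P) (h : H) (n : ℕ) :
    MemLp (fun ω => X h ω ^ n) 2 P := by
  refine (hX.memLp_exp_abs h).of_le_mul (c := n.factorial)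
    ((hX.aemeasurable h).pow_const n).aestronglyMeasurable (ae_of_all _ fun ω => ?_)
  rw [Real.norm_of_nonneg (Real.exp_pos _).le, norm_pow, Real.norm_eq_abs]
  have := Real.pow_div_factorial_le_exp |X h ω| (abs_nonneg _) n
  rwa [div_le_iff₀' (by positivity)] at this

theorem IsIsonormal.memLp_eval (hX : IsIsonormal X P) (h : H) (p : Polynomial ℝ) :
    MemLp (fun ω => p.eval (X h ω)) 2 P := by
  simp only [Polynomial.eval_eq_sum_range]
  exact memLp_finsetSum _ fun i _ => (hX.memLp_pow h i).const_mul _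

end Moments

/-! ### Wiener chaoses as Ornstein-Uhlenbeck eigenspaces -/

section Chaos

variable {Ω H : Type*} [MeasurableSpace Ω] [NormedAddCommGroup H] [InnerProductSpace ℝ H]
  {X : H → Ω → ℝ} {P : Measure Ω}

/-- `Y` is an element of the domain of `D` with derivative `V`, on which the Ornstein-Uhlenbeck
operator (in its weak form) acts as multiplication by `q`. -/
def IsEigenDeriv (X : H → Ω → ℝ) (P : Measure Ω) (q : ℕ) (Y : Lp ℝ 2 P) (V : Lp H 2 P) : Prop :=
  IsMalliavinDeriv X P Y V ∧
    ∀ S W, IsMalliavinDeriv X P S W → inner ℝ W V = (q : ℝ) * inner ℝ S Y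

/-- The weak equation is tested on the pair itself. This identity controls derivatives by values
within an eigenspace. -/
theorem IsEigenDeriv.norm_sq {q : ℕ} {Y : Lp ℝ 2 P} {V : Lp H 2 P}
    (h : IsEigenDeriv X P q Y V) : ‖V‖ ^ 2 = q * ‖Y‖ ^ 2 := by
  rw [← real_inner_self_eq_norm_sq, ← real_inner_self_eq_norm_sq, h.2 Y V h.1]

variable [IsProbabilityMeasure P]

/-- The eigenspace of the Ornstein-Uhlenbeck operator for the eigenvalue `q`. -/
noncomputable def eigenspace (hX : IsIsonormal X P) (q : ℕ) : Submodule ℝ (Lp ℝ 2 P) where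
  carrier := {Y | ∃ V, IsEigenDeriv X P q Y V}
  zero_mem' := ⟨0, IsMalliavinDeriv.zero, fun S W _ => by simp⟩
  add_mem' := by
    rintro Y Y' ⟨V, h1, h2⟩ ⟨V', h3, h4⟩
    refine ⟨V + V', h1.add hX h3, fun S W h => ?_⟩
    rw [inner_add_right, inner_add_right, h2 S W h, h4 S W h, mul_add]
  smul_mem' := by
    rintro c Y ⟨V, h1, h2⟩
    refine ⟨c • V, h1.smul c, fun S W h => ?_⟩
    rw [inner_smul_right, inner_smul_right, h2 S W h]
    ring

/-- Derivatives are √q times as far apart as the variables, so they converge along with them, and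
both defining conditions pass to the limit. -/
theorem isClosed_eigenspace [CompleteSpace H] (hX : IsIsonormal X P) (q : ℕ) :
    IsClosed (eigenspace hX q : Set (Lp ℝ 2 P)) := by
  refine IsSeqClosed.isClosed fun Y Y₀ hY hlim => ?_
  choose V hV using hY
  have hsub : ∀ m n, IsEigenDeriv X P q (Y m - Y n) (V m - V n) := fun m n =>
    ⟨(derivGraph hX).sub_mem (hV m).1 (hV n).1, fun S W h => by
      rw [inner_sub_right, inner_sub_right, (hV m).2 S W h, (hV n).2 S W h, mul_sub]⟩
  have hdist : ∀ m n, dist (V m) (V n) = √q * dist (Y m) (Y n) := fun m n => by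
    rw [dist_eq_norm, dist_eq_norm, ← Real.sqrt_sq (norm_nonneg (V m - V n)), (hsub m n).norm_sq,
      Real.sqrt_mul (Nat.cast_nonneg q), Real.sqrt_sq (norm_nonneg _)]
  have hc : CauchySeq V := by
    refine Metric.cauchySeq_iff.2 fun ε hε => ?_
    -- The added 1 covers q = 0.
    obtain ⟨N, hN⟩ := Metric.cauchySeq_iff.1 hlim.cauchySeq (ε / (√q + 1)) (by positivity)
    refine ⟨N, fun m hm n hn => ?_⟩
    have := hN m hm n hn
    rw [lt_div_iff₀ (by positivity)] at this
    rw [hdist]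
    nlinarith [dist_nonneg (x := Y m) (y := Y n)]
  obtain ⟨V₀, hV₀⟩ := cauchySeq_tendsto_of_complete hc
  refine ⟨V₀, ?_, fun S W h => ?_⟩
  · exact (isClosed_derivGraph hX).mem_of_tendsto (hlim.prodMk_nhds hV₀)
      (Eventually.of_forall fun n => (hV n).1)
  · refine tendsto_nhds_unique (tendsto_const_nhds.inner hV₀)
      (((tendsto_const_nhds.inner hlim).const_mul (q : ℝ)).congr fun n => ?_)
    exact ((hV n).2 S W h).symm

theorem hasFDerivAt_polynomial_eval (p : Polynomial ℝ) (x : Unit → ℝ) :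
    HasFDerivAt (fun x : Unit → ℝ => p.eval (x ()))
      (p.derivative.eval (x ()) •
        (ContinuousLinearMap.proj () : (Unit → ℝ) →L[ℝ] ℝ)) x :=
  HasDerivAt.comp_hasFDerivAt (h₂ := fun y => p.eval y) (f := fun x : Unit → ℝ => x ()) x
    (p.hasDerivAt (x ())) (ContinuousLinearMap.proj () : (Unit → ℝ) →L[ℝ] ℝ).hasFDerivAt

theorem contDiff_polynomial_eval (p : Polynomial ℝ) (n : WithTop ℕ∞) :
    ContDiff ℝ n (fun x : Unit → ℝ => p.eval (x ())) :=
  p.contDiff_aeval (R := ℝ) (𝕜 := ℝ) n |>.comp (contDiff_apply ℝ ℝ ())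

/-- The derivative is p(X(h))h with p the derivative of the Hermite polynomial. Its divergence
p(X(h))X(h) - p'(X(h)) is (q + 1)Y by the Hermite differential equation. -/
theorem IsIsonormal.isEigenDeriv_hermite (hX : IsIsonormal X P) {h : H} (hh : ‖h‖ = 1) (q : ℕ)
    {Y : Lp ℝ 2 P} (hY : ∀ᵐ ω ∂P, Y ω = (hermiteReal (q + 1)).eval (X h ω)) :
    ∃ V, IsEigenDeriv X P (q + 1) Y V := by
  set p : Polynomial ℝ := Polynomial.derivative (hermiteReal (q + 1)) with hp
  have hpV : MemLp (fun ω => p.eval (X h ω) • h) 2 P := by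
    refine (hX.memLp_eval h p).of_le_mul (c := ‖h‖)
      ((hX.memLp_eval h p).1.smul_const h) (ae_of_all _ fun ω => ?_)
    rw [norm_smul, mul_comm]
  have hV := MemLp.coeFn_toLp hpV
  refine ⟨hpV.toLp _, ?_, fun S W hSW => ?_⟩
  · refine hX.isMalliavinDeriv_of_contDiff (ι := Unit) (fun _ => h)
      (contDiff_polynomial_eval (hermiteReal (q + 1)) _) ?_ hY ?_
    · simp only [(hasFDerivAt_polynomial_eval _ _).fderiv]
      refine (hX.memLp_eval h p).of_le_mul
        (c := ‖(ContinuousLinearMap.proj () : (Unit → ℝ) →L[ℝ] ℝ)‖)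
        ((hX.memLp_eval h p).1.smul_const _) (ae_of_all _ fun ω => ?_)
      rw [norm_smul, mul_comm]
    · filter_upwards [hV] with ω e
      rw [e, (hasFDerivAt_polynomial_eval _ _).fderiv, map_smul, gradMap_apply]
      simp [hp]
  · have hM : ∀ᵐ ω ∂P, (((q + 1 : ℕ) : ℝ) • Y : Lp ℝ 2 P) ω =
        p.eval (X h ω) * X h ω - p.derivative.eval (X h ω) := by
      filter_upwards [hY, Lp.coeFn_smul ((q + 1 : ℕ) : ℝ) Y] with ω e1 e2
      rw [e2, Pi.smul_apply, e1, hp, derivative_hermiteReal_succ, hermiteReal_succ]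
      simp
      ring
    rw [hSW.inner_eq hX hh (κ := Unit) (fun _ => h) (contDiff_polynomial_eval p 1) hV
      (M := ((q + 1 : ℕ) : ℝ) • Y) ?_, inner_smul_right]
    filter_upwards [hM] with ω e
    rw [e, (hasFDerivAt_polynomial_eval _ _).fderiv]
    simp [hh]

theorem chaos_le_eigenspace [CompleteSpace H] (hX : IsIsonormal X P) (q : ℕ) :
    chaos X P q ≤ eigenspace hX q := by
  refine Submodule.topologicalClosure_minimal _ (Submodule.span_le.2 ?_) (isClosed_eigenspace hX q)
  cases q with
  | zero =>
    intro Y hY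
    refine ⟨0, ?_, fun S W _ => by simp⟩
    refine hX.isMalliavinDeriv_of_contDiff (ι := Unit) (fun _ => 0) (g := fun _ => 1)
      contDiff_const ?_ hY ?_
    · simp only [fderiv_const_apply]
      exact memLp_const (0 : (Unit → ℝ) →L[ℝ] ℝ)
    · filter_upwards [Lp.coeFn_zero H 2 P] with ω h
      simpa only [Pi.zero_apply, fderiv_const_apply, map_zero] using h
  | succ q =>
    rintro Y ⟨h, hh, hY⟩
    exact hX.isEigenDeriv_hermite hh q (by simpa only [aeval_hermite_eq] using hY)

/-- Evaluating ⟨V, V'⟩ through either eigenvalue equation gives (q - p)⟨Y, Y'⟩ = 0. -/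
theorem inner_eq_zero_of_mem_chaos [CompleteSpace H] (hX : IsIsonormal X P) {p q : ℕ} (hpq : p ≠ q)
    {Y Y' : Lp ℝ 2 P} (hY : Y ∈ chaos X P p) (hY' : Y' ∈ chaos X P q) :
    inner ℝ Y Y' = (0 : ℝ) := by
  obtain ⟨V, hV⟩ := chaos_le_eigenspace hX p hY
  obtain ⟨V', hV'⟩ := chaos_le_eigenspace hX q hY'
  have h1 := hV.2 Y' V' hV'.1
  have h2 := hV'.2 Y V hV.1
  rw [real_inner_comm, h2, real_inner_comm Y' Y] at h1
  have : ((q : ℝ) - p) * inner ℝ Y' Y = 0 := by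
    rw [real_inner_comm] at h1 ⊢
    linarith
  rcases mul_eq_zero.1 this with h | h
  · exact absurd (by exact_mod_cast (sub_eq_zero.1 h).symm) hpq
  · rw [real_inner_comm, h]

end Chaos

/-! ### Totality of the chaoses among functionals of X -/

section Totality

variable {Ω H : Type*} [MeasurableSpace Ω] [NormedAddCommGroup H] [InnerProductSpace ℝ H]
  {X : H → Ω → ℝ} {P : Measure Ω}

theorem L2_inner_toLp {R : Lp ℝ 2 P} {f : Ω → ℝ} (hf : MemLp f 2 P) :
    inner ℝ R (hf.toLp f) = ∫ ω, R ω * f ω ∂P := by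
  rw [L2.inner_def]
  refine integral_congr_ae ?_
  filter_upwards [hf.coeFn_toLp] with ω e
  simp [e, mul_comm]

theorem integral_mul_eval_eq_zero [IsProbabilityMeasure P] (hX : IsIsonormal X P) {R : Lp ℝ 2 P}
    (hR : ∀ q, ∀ Y ∈ chaos X P q, inner ℝ R Y = (0 : ℝ)) {h : H} (hh : ‖h‖ = 1)
    (p : Polynomial ℝ) : ∫ ω, R ω * p.eval (X h ω) ∂P = 0 := by
  have hp : p ∈ Submodule.span ℝ (range hermiteReal) := by
    rw [span_hermiteReal]; exact Submodule.mem_top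
  have hint : ∀ p : Polynomial ℝ, Integrable (fun ω => R ω * p.eval (X h ω)) P := fun p =>
    (Lp.memLp R).integrable_mul (hX.memLp_eval h p)
  induction hp using Submodule.span_induction with
  | mem p hp =>
    obtain ⟨q, rfl⟩ := hp
    rw [← L2_inner_toLp (hX.memLp_eval h (hermiteReal q))]
    refine hR q _ (Submodule.le_topologicalClosure _ (Submodule.subset_span ?_))
    have e := (hX.memLp_eval h (hermiteReal q)).coeFn_toLp
    cases q with
    | zero =>
      change ∀ᵐ ω ∂P, _ = _
      filter_upwards [e] with ω e
      rw [e, hermiteReal_zero, Polynomial.eval_one]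
    | succ q =>
      refine ⟨h, hh, ?_⟩
      filter_upwards [e] with ω e
      rw [e, aeval_hermite_eq]
  | zero => simp
  | add p p' _ _ h1 h2 =>
    simp only [Polynomial.eval_add, mul_add]
    rw [integral_add (hint p) (hint p'), h1, h2, add_zero]
  | smul c p _ h1 =>
    simp only [Polynomial.eval_smul, smul_eq_mul, mul_left_comm _ c]
    rw [integral_const_mul, h1, mul_zero]

theorem integral_mul_pow_eq_zero [IsProbabilityMeasure P] (hX : IsIsonormal X P) {R : Lp ℝ 2 P}
    (hR : ∀ q, ∀ Y ∈ chaos X P q, inner ℝ R Y = (0 : ℝ)) (h : H) (n : ℕ) :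
    ∫ ω, R ω * X h ω ^ n ∂P = 0 := by
  -- Hermite generators exist only for unit vectors. A nonzero h is normalized; for h = 0 the power
  -- is almost surely constant and the zeroth chaos applies.
  rcases eq_or_ne h 0 with rfl | hh
  · have h0 : ∫ ω, R ω ∂P = 0 := by
      have hc : MemLp (fun _ : Ω => (1 : ℝ)) 2 P := memLp_const 1
      have := L2_inner_toLp (R := R) hc
      simp only [mul_one] at this
      rw [← this]
      refine hR 0 _ (Submodule.le_topologicalClosure _ (Submodule.subset_span ?_))
      exact hc.coeFn_toLp
    have e : ∫ ω, R ω * X 0 ω ^ n ∂P = ∫ ω, R ω * 0 ^ n ∂P := by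
      refine integral_congr_ae ?_
      filter_upwards [hX.ae_smul 0 (0 : H)] with ω e
      rw [zero_smul, zero_mul] at e
      rw [e]
    rw [e, integral_mul_const, h0, zero_mul]
  · have h1 := integral_mul_eval_eq_zero hX hR (h := ‖h‖⁻¹ • h) (by simp [norm_smul, hh])
      (Polynomial.C (‖h‖ ^ n) * Polynomial.X ^ n)
    rw [← h1]
    refine integral_congr_ae ?_
    filter_upwards [hX.ae_smul ‖h‖⁻¹ h] with ω e
    have : ‖h‖ ≠ 0 := norm_ne_zero_iff.2 hh
    rw [e]
    simp only [Polynomial.eval_mul, Polynomial.eval_C, Polynomial.eval_pow, Polynomial.eval_X]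
    rw [← mul_pow, mul_inv_cancel_left₀ this]

/-- Expand the exponential in powers of X(h): every term integrates to zero, and the series is
dominated by |R| exp|X(h)|, a product of two L² functions. -/
theorem integral_mul_cexp_eq_zero [IsProbabilityMeasure P] (hX : IsIsonormal X P) {R : Lp ℝ 2 P}
    (hR : ∀ q, ∀ Y ∈ chaos X P q, inner ℝ R Y = (0 : ℝ)) (h : H) :
    ∫ ω, (R ω : ℂ) * Complex.exp (X h ω * Complex.I) ∂P = 0 := by
  have hRm : AEStronglyMeasurable R P := Lp.aestronglyMeasurable R
  have hm : ∀ n : ℕ, AEStronglyMeasurable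
      (fun ω => (R ω : ℂ) * ((X h ω * Complex.I) ^ n / n.factorial)) P := fun n =>
    (Complex.continuous_ofReal.comp_aestronglyMeasurable hRm).mul
      ((Complex.continuous_ofReal.comp_aestronglyMeasurable
        (hX.aemeasurable h).aestronglyMeasurable).mul_const Complex.I |>.pow n |>.mul_const _)
  have hsum := hasSum_integral_of_dominated_convergence (μ := P)
    (F := fun (n : ℕ) ω => (R ω : ℂ) * ((X h ω * Complex.I) ^ n / n.factorial))
    (f := fun ω => (R ω : ℂ) * Complex.exp (X h ω * Complex.I))
    (fun n ω => |R ω| * (|X h ω| ^ n / n.factorial)) hm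
    (fun n => ae_of_all _ fun ω => by simp)
    (ae_of_all _ fun ω => (Real.summable_pow_div_factorial _).mul_left _) ?_
    (ae_of_all _ fun ω => by
      rw [Complex.exp_eq_exp_ℂ]
      exact (NormedSpace.expSeries_div_hasSum_exp (X h ω * Complex.I)).mul_left _)
  · rw [← hsum.tsum_eq]
    refine (tsum_congr fun n => ?_).trans tsum_zero
    have e : ∀ ω, (R ω : ℂ) * ((X h ω * Complex.I) ^ n / n.factorial) =
        ((R ω * X h ω ^ n : ℝ) : ℂ) * (Complex.I ^ n / n.factorial) := fun ω => by
      push_cast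
      rw [mul_pow]
      ring
    simp only [e]
    rw [integral_mul_const, integral_complex_ofReal, integral_mul_pow_eq_zero hX hR h n]
    simp
  · have e : ∀ ω, ∑' n : ℕ, |R ω| * (|X h ω| ^ n / n.factorial) = |R ω| * Real.exp |X h ω| :=
      fun ω => by
        rw [tsum_mul_left, Real.exp_eq_exp_ℝ, (NormedSpace.expSeries_div_hasSum_exp _).tsum_eq]
    simp only [e]
    exact (Lp.memLp R).abs.integrable_mul (hX.memLp_exp_abs h)

/-- An element of `L²` orthogonal to all chaoses is orthogonal to all bounded continuous functions
of finitely many `X(φᵢ)`. -/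
theorem integral_mul_comp_eq_zero [IsProbabilityMeasure P] (hX : IsIsonormal X P) {R : Lp ℝ 2 P}
    (hR : ∀ q, ∀ Y ∈ chaos X P q, inner ℝ R Y = (0 : ℝ)) {ι : Type*} [Fintype ι] (φ : ι → H)
    {g : (ι → ℝ) → ℝ} (hg : Continuous g) (hgb : ∃ C, ∀ x, ‖g x‖ ≤ C) :
    ∫ ω, R ω * g (fun i => X (φ i) ω) ∂P = 0 := by
  classical
  have hRi : Integrable R P := (Lp.memLp R).integrable one_le_two
  have hRm : Measurable R := (Lp.stronglyMeasurable R).measurable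
  have hφ : AEMeasurable (fun ω i => X (φ i) ω) P := hX.aemeasurable_pi φ
  have hfin : ∀ f : Ω → ℝ, Integrable f P →
      IsFiniteMeasure (P.withDensity fun ω => ENNReal.ofReal (f ω)) := fun f hf =>
    isFiniteMeasure_withDensity_ofReal hf.2
  -- Since `ENNReal.ofReal` truncates at 0, μ(R) and μ(-R) are the images of the positive and
  -- negative parts of R·P.
  let μ : (Ω → ℝ) → Measure (ι → ℝ) := fun f =>
    (P.withDensity fun ω => ENNReal.ofReal (f ω)).map fun ω i => X (φ i) ω
  have hac : ∀ f : Ω → ℝ, P.withDensity (fun ω => ENNReal.ofReal (f ω)) ≪ P := fun f =>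
    withDensity_absolutelyContinuous _ _
  have hint : ∀ {E : Type} [NormedAddCommGroup E] [NormedSpace ℝ E] [CompleteSpace E]
      (f : Ω → ℝ), Measurable f → ∀ (G : (ι → ℝ) → E), Continuous G →
      ∫ x, G x ∂(μ f) = ∫ ω, (max (f ω) 0) • G (fun i => X (φ i) ω) ∂P := by
    intro E _ _ _ f hf G hG
    rw [integral_map (hφ.mono_ac (hac f)) hG.aestronglyMeasurable,
      integral_withDensity_eq_integral_toReal_smul hf.ennreal_ofReal
        (ae_of_all _ fun ω => ENNReal.ofReal_lt_top)]
    simp [ENNReal.toReal_ofReal']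
  have hbdd : ∀ {E : Type} [NormedAddCommGroup E] [NormedSpace ℝ E]
      (f : Ω → ℝ), Integrable f P → ∀ (G : (ι → ℝ) → E), Continuous G → (∃ C, ∀ x, ‖G x‖ ≤ C) →
      Integrable (fun ω => (max (f ω) 0) • G (fun i => X (φ i) ω)) P := by
    rintro E _ _ f hf G hG ⟨C, hC⟩
    exact hf.pos_part.smul_bdd C (hG.comp_aestronglyMeasurable hφ.aestronglyMeasurable)
      (ae_of_all _ fun ω => hC _)
  have hmax : ∀ r : ℝ, max r 0 - max (-r) 0 = r := fun r => by
    rcases le_total r 0 with h | h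
    · rw [max_eq_right h, max_eq_left (by linarith)]; ring
    · rw [max_eq_left h, max_eq_right (by linarith)]; ring
  have hdiff : ∀ {E : Type} [NormedAddCommGroup E] [NormedSpace ℝ E] [CompleteSpace E]
      (G : (ι → ℝ) → E), Continuous G → (∃ C, ∀ x, ‖G x‖ ≤ C) →
      ∫ x, G x ∂(μ R) - ∫ x, G x ∂(μ (-R)) = ∫ ω, R ω • G (fun i => X (φ i) ω) ∂P := by
    intro E _ _ _ G hG hb
    rw [hint _ hRm G hG, hint _ hRm.neg G hG,
      ← integral_sub (hbdd _ hRi G hG hb) (hbdd _ hRi.neg G hG hb)]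
    refine integral_congr_ae (ae_of_all _ fun ω => ?_)
    simp only [Pi.neg_apply]
    rw [← sub_smul, hmax]
  have hμfin1 : IsFiniteMeasure (μ R) := by
    have := hfin R hRi
    infer_instance
  have hμfin2 : IsFiniteMeasure (μ (-R)) := by
    have := hfin (-R) hRi.neg
    infer_instance
  -- Equal characteristic functions: by linearity of X, a linear form in the X(φᵢ) is again some
  -- X(h).
  have hμ : μ R = μ (-R) := by
    refine Measure.ext_of_charFunDual (funext fun L => sub_eq_zero.1 ?_)
    simp only [charFunDual_apply]
    rw [hdiff (fun v => Complex.exp (L v * Complex.I)) (by fun_prop)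
      ⟨1, fun x => (Complex.norm_exp_ofReal_mul_I _).le⟩,
      ← integral_mul_cexp_eq_zero hX hR (∑ i, L (Pi.single i 1) • φ i)]
    refine integral_congr_ae ?_
    filter_upwards [hX.ae_sum Finset.univ (fun i => L (Pi.single i 1)) φ] with ω e
    have : L (fun i => X (φ i) ω) = ∑ i, L (Pi.single i 1) * X (φ i) ω := by
      rw [← L.coe_coe, LinearMap.pi_apply_eq_sum_univ L.toLinearMap]
      refine Finset.sum_congr rfl fun i _ => ?_
      rw [smul_eq_mul, mul_comm]
      congr 2
      ext j
      simp [Pi.single_apply, eq_comm]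
    rw [e, this, Complex.real_smul]
  have := hdiff g hg hgb
  rw [hμ, sub_self] at this
  simpa using this.symm

/-- The chaoses need not span all of L², as the σ-algebra may exceed that of X, but they do span the
cylindrical variables and hence the domain of D. -/
theorem inner_eq_zero_of_orthogonal_chaos [IsProbabilityMeasure P] (hX : IsIsonormal X P)
    {R : Lp ℝ 2 P} (hR : ∀ q, ∀ Y ∈ chaos X P q, inner ℝ R Y = (0 : ℝ)) {S : Lp ℝ 2 P}
    {W : Lp H 2 P} (hSW : IsMalliavinDeriv X P S W) : inner ℝ R S = (0 : ℝ) := by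
  suffices closure (cylindricalGraph X P) ⊆ {p | inner ℝ R p.1 = (0 : ℝ)} from this hSW
  refine closure_minimal ?_ (isClosed_eq (by fun_prop) (by fun_prop))
  rintro ⟨S, W⟩ h
  obtain ⟨n, g, φ, hn, hg, hgc, e1, e2⟩ := mem_cylindricalGraph_iff.1 h
  rw [mem_ofPred_eq, L2.inner_def,
    ← integral_mul_comp_eq_zero hX hR φ hg.continuous
      (hgc.exists_bound_of_continuous hg.continuous)]
  refine integral_congr_ae ?_
  filter_upwards [e1] with ω e
  simp [e, mul_comm]

end Totality

/-! ### The inverse generator and the divergence of -DL⁻¹F -/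

section InverseGenerator

variable {Ω H : Type*} [MeasurableSpace Ω] [NormedAddCommGroup H] [InnerProductSpace ℝ H]
  [CompleteSpace H] {X : H → Ω → ℝ} {P : Measure Ω} [IsProbabilityMeasure P]

/-- `L⁻¹F` is in the domain of `D`, and `-DL⁻¹F` is a vector field with divergence `F`. -/
theorem exists_isMalliavinDeriv_Linv (hX : IsIsonormal X P) {F : Lp ℝ 2 P}
    (hF : ∫ ω, F ω ∂P = 0) :
    ∃ V, IsMalliavinDeriv X P (Linv X P F) V ∧
      ∀ S W, IsMalliavinDeriv X P S W → inner ℝ W (-V) = (inner ℝ S F : ℝ) := by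
  set a : ℕ → Lp ℝ 2 P := fun q => J X P (q + 1) F with ha
  have hmem : ∀ q, a q ∈ chaos X P (q + 1) := fun q => Submodule.starProjection_apply_mem _ _
  have hproj : ∀ q, ∀ Y ∈ chaos X P (q + 1), inner ℝ F Y = (inner ℝ (a q) Y : ℝ) := by
    intro q Y hY
    have := Submodule.starProjection_inner_eq_zero F Y hY
    rwa [inner_sub_left, sub_eq_zero] at this
  have horth : Pairwise fun i j => inner ℝ (a i) (a j) = (0 : ℝ) := fun i j hij =>
    inner_eq_zero_of_mem_chaos hX (by simpa using hij) (hmem i) (hmem j)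
  have hsq : Summable fun q => ‖a q‖ ^ 2 := summable_norm_sq_of_inner_eq (x := F) horth fun q => by
    rw [hproj q _ (hmem q), real_inner_self_eq_norm_sq]
  choose v hv using fun q => chaos_le_eigenspace hX (q + 1) (hmem q)
  set c : ℕ → ℝ := fun q => -(1 / ((q : ℝ) + 1)) with hc
  have hc1 : ∀ q, |c q| ≤ 1 := fun q => by
    rw [hc, abs_neg, abs_of_nonneg (by positivity), div_le_one (by positivity)]
    simp
  have hsa : Summable a := summable_of_pairwise_orthogonal horth hsq
  have hsca : Summable fun q => c q • a q := by
    refine summable_of_pairwise_orthogonal (fun i j hij => ?_)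
      (hsq.of_nonneg_of_le (fun q => by positivity) fun q => ?_)
    · simp only [inner_smul_left, inner_smul_right, horth hij, mul_zero]
    · rw [norm_smul, mul_pow, Real.norm_eq_abs, sq_abs]
      exact mul_le_of_le_one_left (by positivity) ((sq_le_one_iff_abs_le_one _).2 (hc1 q))
  -- Since ‖v q‖² = (q + 1)‖a q‖², the squared norms of the terms are ‖a q‖²/(q + 1).
  have hscv : Summable fun q => c q • v q := by
    refine summable_of_pairwise_orthogonal (fun i j hij => ?_)
      (hsq.of_nonneg_of_le (fun q => by positivity) fun q => ?_)
    · simp only [inner_smul_left, inner_smul_right, (hv j).2 _ _ (hv i).1, horth hij, mul_zero]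
    · rw [norm_smul, mul_pow, (hv q).norm_sq, Real.norm_eq_abs, sq_abs, ← mul_assoc]
      refine mul_le_of_le_one_left (by positivity) ?_
      have : (c q) ^ 2 * ((q + 1 : ℕ) : ℝ) = 1 / ((q : ℝ) + 1) := by
        rw [hc]; push_cast; field_simp
      rw [this, div_le_one (by positivity)]
      simp
  have hderiv : IsMalliavinDeriv X P (Linv X P F) (∑' q, c q • v q) := by
    refine (isClosed_derivGraph hX).mem_of_tendsto (hsca.hasSum.prodMk_nhds hscv.hasSum)
      (Eventually.of_forall fun s => ?_)
    have := (derivGraph hX).sum_mem (t := s) (f := fun q => (c q • a q, c q • v q))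
      fun q _ => (hv q).1.smul (c q)
    have e : ∑ q ∈ s, (c q • a q, c q • v q) = (∑ q ∈ s, c q • a q, ∑ q ∈ s, c q • v q) :=
      Prod.ext (by simp [Prod.fst_sum]) (by simp [Prod.snd_sum])
    rwa [e] at this
  refine ⟨_, hderiv, fun S W hSW => ?_⟩
  -- The remainder of F is orthogonal to every chaos; for the constants this is the zero mean. It is
  -- therefore orthogonal to S.
  have hS : inner ℝ S (∑' q, a q) = (inner ℝ S F : ℝ) := by
    have hR : ∀ q, ∀ Y ∈ chaos X P q, inner ℝ (F - ∑' q, a q) Y = (0 : ℝ) := by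
      intro q Y hY
      have hsum := (hsa.hasSum.mapL (innerSL ℝ Y)).tsum_eq
      simp only [innerSL_apply_apply] at hsum
      rw [real_inner_comm, inner_sub_right, ← hsum, sub_eq_zero]
      cases q with
      | zero =>
        have h0 : chaos X P 0 ≤ (ℝ ∙ F)ᗮ := by
          refine Submodule.topologicalClosure_minimal _ (Submodule.span_le.2 fun Y hY => ?_)
            (Submodule.isClosed_orthogonal _)
          rw [SetLike.mem_coe, Submodule.mem_orthogonal_singleton_iff_inner_right, L2.inner_def,
            ← hF]
          refine integral_congr_ae ?_
          filter_upwards [show ∀ᵐ ω ∂P, Y ω = 1 from hY] with ω e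
          simp [e]
        rw [Submodule.mem_orthogonal_singleton_iff_inner_left.1 (h0 hY)]
        refine ((tsum_congr fun q => ?_).trans tsum_zero).symm
        exact inner_eq_zero_of_mem_chaos hX (by simp) hY (hmem q)
      | succ p =>
        rw [tsum_eq_single p fun q hq =>
          inner_eq_zero_of_mem_chaos hX (by simpa using hq.symm) hY (hmem q), real_inner_comm,
          hproj p Y hY, real_inner_comm]
    have := inner_eq_zero_of_orthogonal_chaos hX hR hSW
    rw [inner_sub_left, sub_eq_zero] at this
    rw [real_inner_comm, ← this, real_inner_comm]
  rw [inner_neg_right, ← hS]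
  have h1 := (hscv.hasSum.mapL (innerSL ℝ W)).tsum_eq
  have h2 := (hsa.hasSum.mapL (innerSL ℝ S)).tsum_eq
  simp only [innerSL_apply_apply] at h1 h2
  rw [← h1, ← h2, ← tsum_neg]
  refine tsum_congr fun q => ?_
  rw [inner_smul_right, (hv q).2 S W hSW, hc]
  push_cast
  field_simp

end InverseGenerator

/-! ### Smoothing of C¹ functions -/

section Mollification

open scoped Convolution in
/-- A continuous function bounded by `C` is a pointwise limit of smooth functions bounded
by `C`. -/
theorem exists_smooth_tendsto {f : ℝ → ℝ} (hf : Continuous f) {C : ℝ} (hC : ∀ x, |f x| ≤ C) :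
    ∃ g : ℕ → ℝ → ℝ, (∀ n, ContDiff ℝ (⊤ : ℕ∞) (g n)) ∧ (∀ n x, |g n x| ≤ C) ∧
      ∀ x, Tendsto (fun n => g n x) atTop (𝓝 (f x)) := by
  let ρ : ℕ → ContDiffBump (0 : ℝ) := fun n =>
    ⟨1 / ((n : ℝ) + 1) / 2, 1 / ((n : ℝ) + 1), by positivity, half_lt_self (by positivity)⟩
  refine ⟨fun n => (ρ n).normed volume ⋆[ContinuousLinearMap.lsmul ℝ ℝ, volume] f, fun n => ?_,
    fun n x => ?_, fun x => ?_⟩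
  · exact (ρ n).hasCompactSupport_normed.contDiff_convolution_left _ (ρ n).contDiff_normed
      hf.locallyIntegrable
  · change |∫ t, ContinuousLinearMap.lsmul ℝ ℝ ((ρ n).normed volume t) (f (x - t))| ≤ C
    rw [← Real.norm_eq_abs]
    refine (norm_integral_le_of_norm_le (g := fun t => (ρ n).normed volume t * C)
      ((ρ n).integrable_normed.mul_const C) (ae_of_all _ fun t => ?_)).trans ?_
    · rw [ContinuousLinearMap.lsmul_apply, norm_smul, Real.norm_of_nonneg ((ρ n).nonneg_normed t)]
      exact mul_le_mul_of_nonneg_left (hC _) ((ρ n).nonneg_normed t)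
    · rw [integral_mul_const, (ρ n).integral_normed, one_mul]
  · exact ContDiffBump.convolution_tendsto_right_of_continuous
      tendsto_one_div_add_atTop_nhds_zero_nat hf x

/-- A `C¹` function with derivative bounded by `C` is a pointwise limit of smooth functions with
derivatives bounded by `C` converging pointwise. -/
theorem exists_smooth_tendsto_of_hasDerivAt {f f' : ℝ → ℝ} (hf : ∀ x, HasDerivAt f (f' x) x)
    (hf' : Continuous f') {C : ℝ} (hC : ∀ x, |f' x| ≤ C) :
    ∃ g g' : ℕ → ℝ → ℝ, (∀ n, ContDiff ℝ (⊤ : ℕ∞) (g n)) ∧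
      (∀ n x, HasDerivAt (g n) (g' n x) x) ∧ (∀ n x, |g' n x| ≤ C) ∧
      (∀ n, g n 0 = f 0) ∧
      (∀ x, Tendsto (fun n => g n x) atTop (𝓝 (f x))) ∧
      ∀ x, Tendsto (fun n => g' n x) atTop (𝓝 (f' x)) := by
  obtain ⟨g', h1, h2, h3⟩ := exists_smooth_tendsto hf' hC
  -- The derivative is mollified and integrated from 0, so the value at 0 is exact and gives a
  -- growth bound uniform in n.
  have hd : ∀ n x, HasDerivAt (fun x => f 0 + ∫ t in (0 : ℝ)..x, g' n t) (g' n x) x := fun n x =>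
    ((h1 n).continuous.integral_hasStrictDerivAt 0 x).hasDerivAt.const_add _
  refine ⟨fun n x => f 0 + ∫ t in (0 : ℝ)..x, g' n t, g', fun n => ?_, hd, h2, fun n => by simp,
    fun x => ?_, h3⟩
  · refine contDiff_infty_iff_deriv.2 ⟨fun x => (hd n x).differentiableAt, ?_⟩
    rw [funext fun x => (hd n x).deriv]
    exact h1 n
  · have e : f x = f 0 + ∫ t in (0 : ℝ)..x, f' t := by
      rw [intervalIntegral.integral_eq_sub_of_hasDerivAt (fun t _ => hf t)
        (hf'.intervalIntegrable _ _)]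
      ring
    rw [e]
    refine Tendsto.const_add _ (intervalIntegral.tendsto_integral_filter_of_dominated_convergence
      (fun _ => C) (Eventually.of_forall fun n => (h1 n).continuous.aestronglyMeasurable)
      (Eventually.of_forall fun n => ae_of_all _ fun t _ => h2 n t) (by simp)
      (ae_of_all _ fun t _ => h3 t))

theorem abs_le_of_abs_deriv_le {f f' : ℝ → ℝ} (hf : ∀ x, HasDerivAt f (f' x) x) {C : ℝ}
    (hC : ∀ x, |f' x| ≤ C) (x y : ℝ) : |f x - f y| ≤ C * |x - y| := by
  have := Convex.norm_image_sub_le_of_norm_hasDerivWithin_le (f := f) (f' := f') (s := univ)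
    (C := C) (x := y) (y := x) (fun x _ => (hf x).hasDerivWithinAt) (fun x _ => hC x) convex_univ
    (mem_univ _) (mem_univ _)
  simpa using this

end Mollification

/-! ### The Stein identity, from cylindrical to general variables -/

section SteinIdentity

variable {Ω H : Type*} [MeasurableSpace Ω] [NormedAddCommGroup H] [InnerProductSpace ℝ H]
  {X : H → Ω → ℝ} {P : Measure Ω}

theorem norm_integral_le_mul_norm_mul_norm {E₁ E₂ : Type*} [NormedAddCommGroup E₁]
    [NormedAddCommGroup E₂] (A : Lp E₁ 2 P) (B : Lp E₂ 2 P) {C : ℝ} (hC : 0 ≤ C) {φ : Ω → ℝ}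
    (hφ : ∀ᵐ ω ∂P, ‖φ ω‖ ≤ C * (‖A ω‖ * ‖B ω‖)) : ‖∫ ω, φ ω ∂P‖ ≤ C * (‖A‖ * ‖B‖) := by
  have hA := (Lp.memLp A).norm
  have hB := (Lp.memLp B).norm
  have nA : ‖hA.toLp _‖ = ‖A‖ := by
    rw [Lp.norm_toLp, eLpNorm_norm, Lp.norm_def]
  have nB : ‖hB.toLp _‖ = ‖B‖ := by
    rw [Lp.norm_toLp, eLpNorm_norm, Lp.norm_def]
  refine (norm_integral_le_of_norm_le ((hA.integrable_mul hB).const_mul C) hφ).trans ?_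
  rw [integral_const_mul]
  refine mul_le_mul_of_nonneg_left ?_ hC
  rw [← nA, ← nB]
  refine le_trans (le_of_eq ?_) (real_inner_le_norm _ _)
  rw [L2.inner_def]
  refine integral_congr_ae ?_
  filter_upwards [hA.coeFn_toLp, hB.coeFn_toLp] with ω e1 e2
  simp [e1, e2, mul_comm]

theorem memLp_comp_of_hasDerivAt [IsFiniteMeasure P] {f f' : ℝ → ℝ}
    (hf : ∀ x, HasDerivAt f (f' x) x) {C : ℝ} (hC : ∀ x, |f' x| ≤ C) (F : Lp ℝ 2 P) :
    MemLp (fun ω => f (F ω)) 2 P := by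
  have hc : Continuous f := continuous_iff_continuousAt.2 fun x => (hf x).continuousAt
  have hB : MemLp (fun ω => |f 0| + C * |F ω|) 2 P :=
    (memLp_const |f 0|).add ((Lp.memLp F).abs.const_mul C)
  refine hB.of_le (hc.comp_aestronglyMeasurable (Lp.aestronglyMeasurable F))
    (ae_of_all _ fun ω => le_trans ?_ (Real.le_norm_self _))
  have h1 := abs_le_of_abs_deriv_le hf hC (F ω) 0
  have h2 := abs_sub_abs_le_abs_sub (f (F ω)) (f 0)
  rw [sub_zero] at h1
  rw [Real.norm_eq_abs]
  linarith

/-- The Stein identity for smooth cylindrical random variables. -/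
theorem stein_identity_of_mem_cylindricalGraph [IsProbabilityMeasure P] (hX : IsIsonormal X P)
    {G : Lp ℝ 2 P} {V : Lp H 2 P}
    (hV : ∀ S W, IsMalliavinDeriv X P S W → inner ℝ W V = (inner ℝ S G : ℝ)) {f f' : ℝ → ℝ}
    (hfs : ContDiff ℝ (⊤ : ℕ∞) f) (hf : ∀ x, HasDerivAt f (f' x) x) {C : ℝ}
    (hC : ∀ x, |f' x| ≤ C) {F : Lp ℝ 2 P} {U : Lp H 2 P} (hFU : (F, U) ∈ cylindricalGraph X P) :
    ∫ ω, G ω * f (F ω) ∂P = ∫ ω, f' (F ω) * inner ℝ (U ω) (V ω) ∂P := by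
  obtain ⟨n, g, φ, hn, hg, hgc, e1, e2⟩ := mem_cylindricalGraph_iff.1 hFU
  have : Nonempty (Fin n) := ⟨⟨0, hn⟩⟩
  have hf'c : Continuous f' := by
    rw [show f' = deriv f from funext fun x => (hf x).deriv.symm]
    exact hfs.continuous_deriv (by simp)
  have hS := memLp_comp_of_hasDerivAt hf hC F
  have hW : MemLp (fun ω => f' (F ω) • U ω) 2 P :=
    (Lp.memLp U).of_le_mul (c := C) ((hf'c.comp_aestronglyMeasurable
      (Lp.aestronglyMeasurable F)).smul (Lp.aestronglyMeasurable U)) (ae_of_all _ fun ω => by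
        rw [norm_smul]
        exact mul_le_mul_of_nonneg_right (hC _) (norm_nonneg _))
  have hd : ∀ x, fderiv ℝ (fun x => f (g x)) x = f' (g x) • fderiv ℝ g x := fun x =>
    ((hf (g x)).comp_hasFDerivAt x (hg.differentiable (by simp) x).hasFDerivAt).fderiv
  have hgm : MemLp (fun ω => fderiv ℝ g (fun i => X (φ i) ω)) 2 P :=
    hX.memLp_of_hasCompactSupport φ (hg.continuous_fderiv (by simp)) (hgc.fderiv (𝕜 := ℝ)) 2
  have hm : AEMeasurable (fun ω i => X (φ i) ω) P := hX.aemeasurable_pi φ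
  -- Test the divergence on (f(F), f'(F)DF). The composite f ∘ g need not have compact support when
  -- f(0) ≠ 0, so the extended criterion is needed.
  have key := hV (hS.toLp _) (hW.toLp _) (hX.isMalliavinDeriv_of_contDiff φ
    (g := fun x => f (g x)) (hfs.comp hg) ?_ ?_ ?_)
  · rw [L2.inner_def, L2.inner_def] at key
    have k1 : ∫ ω, G ω * f (F ω) ∂P = ∫ ω, inner ℝ (hS.toLp (fun ω => f (F ω)) ω) (G ω) ∂P := by
      refine integral_congr_ae ?_
      filter_upwards [hS.coeFn_toLp] with ω e
      simp [e]
    have k2 : ∫ ω, f' (F ω) * inner ℝ (U ω) (V ω) ∂P =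
        ∫ ω, inner ℝ (hW.toLp (fun ω => f' (F ω) • U ω) ω) (V ω) ∂P := by
      refine integral_congr_ae ?_
      filter_upwards [hW.coeFn_toLp] with ω e
      rw [e, real_inner_smul_left]
    rw [k1, k2, key]
  · refine hgm.of_le_mul (c := C) (((hfs.comp hg).continuous_fderiv
      (by simp)).comp_aestronglyMeasurable hm.aestronglyMeasurable) (ae_of_all _ fun ω => ?_)
    rw [hd, norm_smul]
    exact mul_le_mul_of_nonneg_right (hC _) (norm_nonneg _)
  · filter_upwards [hS.coeFn_toLp, e1] with ω h1 h2
    rw [h1, ← h2]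
  · filter_upwards [hW.coeFn_toLp, e1, e2] with ω h1 h2 h3
    rw [h1, hd, map_smul, ← h2, ← h3]

/-- Pass to the limit along cylindrical pairs (Fₖ, Uₖ) with Fₖ converging almost surely. The right
side splits into f'(Fₖ)⟨Uₖ - U, V⟩, small by Cauchy-Schwarz, and f'(Fₖ)⟨U, V⟩, handled by dominated
convergence. -/
theorem stein_identity_of_contDiff [IsProbabilityMeasure P] (hX : IsIsonormal X P)
    {G : Lp ℝ 2 P} {V : Lp H 2 P}
    (hV : ∀ S W, IsMalliavinDeriv X P S W → inner ℝ W V = (inner ℝ S G : ℝ)) {f f' : ℝ → ℝ}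
    (hfs : ContDiff ℝ (⊤ : ℕ∞) f) (hf : ∀ x, HasDerivAt f (f' x) x) {C : ℝ}
    (hC : ∀ x, |f' x| ≤ C) {F : Lp ℝ 2 P} {U : Lp H 2 P} (hFU : IsMalliavinDeriv X P F U) :
    ∫ ω, G ω * f (F ω) ∂P = ∫ ω, f' (F ω) * inner ℝ (U ω) (V ω) ∂P := by
  have hC0 : 0 ≤ C := (abs_nonneg _).trans (hC 0)
  have hf'c : Continuous f' := by
    rw [show f' = deriv f from funext fun x => (hf x).deriv.symm]
    exact hfs.continuous_deriv (by simp)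
  obtain ⟨p, hp, hlim⟩ := mem_closure_iff_seq_limit.1 hFU
  have hF : Tendsto (fun k => (p k).1) atTop (𝓝 F) := (continuous_fst.tendsto _).comp hlim
  have hU : Tendsto (fun k => (p k).2) atTop (𝓝 U) := (continuous_snd.tendsto _).comp hlim
  obtain ⟨ns, hns, hae⟩ := (tendstoInMeasure_of_tendsto_Lp hF).exists_seq_tendsto_ae
  have hF' := hF.comp hns.tendsto_atTop
  have hU' := hU.comp hns.tendsto_atTop
  have hm : ∀ A : Lp ℝ 2 P, AEStronglyMeasurable (fun ω => f' (A ω)) P := fun A =>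
    hf'c.comp_aestronglyMeasurable (Lp.aestronglyMeasurable A)
  have hint : ∀ A : Lp ℝ 2 P, ∀ B : Lp H 2 P,
      Integrable (fun ω => f' (A ω) * inner ℝ (B ω) (V ω)) P := fun A B =>
    (L2.integrable_inner B V).bdd_mul (hm A) (ae_of_all _ fun ω => hC _)
  have hGf : ∀ A : Lp ℝ 2 P, Integrable (fun ω => G ω * f (A ω)) P := fun A =>
    (Lp.memLp G).integrable_mul (memLp_comp_of_hasDerivAt hf hC A)
  have t1 : Tendsto (fun k => ∫ ω, G ω * f ((p (ns k)).1 ω) ∂P) atTop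
      (𝓝 (∫ ω, G ω * f (F ω) ∂P)) := by
    rw [tendsto_iff_norm_sub_tendsto_zero]
    refine squeeze_zero (fun k => norm_nonneg _)
      (g := fun k => C * (‖G‖ * ‖(p (ns k)).1 - F‖)) (fun k => ?_) ?_
    · rw [← integral_sub (hGf _) (hGf _)]
      refine norm_integral_le_mul_norm_mul_norm _ _ hC0 ?_
      filter_upwards [Lp.coeFn_sub (p (ns k)).1 F] with ω e
      rw [e, ← mul_sub, norm_mul, Pi.sub_apply, mul_left_comm]
      exact mul_le_mul_of_nonneg_left (abs_le_of_abs_deriv_le hf hC _ _) (norm_nonneg _)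
    · simpa using ((tendsto_iff_norm_sub_tendsto_zero.1 hF').const_mul ‖G‖).const_mul C
  have t2 : Tendsto (fun k => ∫ ω, f' ((p (ns k)).1 ω) * inner ℝ (((p (ns k)).2 - U : Lp H 2 P) ω)
      (V ω) ∂P) atTop (𝓝 0) := by
    rw [tendsto_zero_iff_norm_tendsto_zero]
    refine squeeze_zero (fun k => norm_nonneg _)
      (g := fun k => C * (‖(p (ns k)).2 - U‖ * ‖V‖)) (fun k => ?_) ?_
    · refine norm_integral_le_mul_norm_mul_norm _ _ hC0 (ae_of_all _ fun ω => ?_)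
      rw [norm_mul]
      exact mul_le_mul (hC _) (norm_inner_le_norm _ _) (norm_nonneg _) hC0
    · simpa using ((tendsto_iff_norm_sub_tendsto_zero.1 hU').mul_const ‖V‖).const_mul C
  have t3 : Tendsto (fun k => ∫ ω, f' ((p (ns k)).1 ω) * inner ℝ (U ω) (V ω) ∂P) atTop
      (𝓝 (∫ ω, f' (F ω) * inner ℝ (U ω) (V ω) ∂P)) := by
    refine tendsto_integral_of_dominated_convergence (fun ω => C * ‖(inner ℝ (U ω) (V ω) : ℝ)‖)
      (fun k => (hint _ _).1) ((L2.integrable_inner U V).norm.const_mul C)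
      (fun k => ae_of_all _ fun ω => ?_) ?_
    · rw [norm_mul]
      exact mul_le_mul_of_nonneg_right (hC _) (norm_nonneg _)
    · filter_upwards [hae] with ω h
      exact ((hf'c.tendsto _).comp h).mul_const _
  refine tendsto_nhds_unique t1 ?_
  have t4 := t2.add t3
  rw [zero_add] at t4
  refine t4.congr fun k => ?_
  rw [← integral_add (hint _ _) (hint _ _),
    stein_identity_of_mem_cylindricalGraph hX hV hfs hf hC (hp (ns k))]
  refine integral_congr_ae ?_
  filter_upwards [Lp.coeFn_sub (p (ns k)).2 U] with ω e
  rw [e, Pi.sub_apply, inner_sub_left]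
  ring

/-- The Stein identity `E[G f(F)] = E[f'(F) ⟨DF, V⟩]` for a vector field `V` with divergence `G`
and a `C¹` function `f` with bounded derivative. -/
theorem stein_identity [IsProbabilityMeasure P] (hX : IsIsonormal X P)
    {G : Lp ℝ 2 P} {V : Lp H 2 P}
    (hV : ∀ S W, IsMalliavinDeriv X P S W → inner ℝ W V = (inner ℝ S G : ℝ)) {f f' : ℝ → ℝ}
    (hf : ∀ x, HasDerivAt f (f' x) x) (hf' : Continuous f') {C : ℝ}
    (hC : ∀ x, |f' x| ≤ C) {F : Lp ℝ 2 P} {U : Lp H 2 P} (hFU : IsMalliavinDeriv X P F U) :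
    ∫ ω, G ω * f (F ω) ∂P = ∫ ω, f' (F ω) * inner ℝ (U ω) (V ω) ∂P := by
  obtain ⟨g, g', hg, hgd, hgC, hg0, hglim, hg'lim⟩ := exists_smooth_tendsto_of_hasDerivAt hf hf' hC
  have hg'c : ∀ n, Continuous (g' n) := fun n => by
    rw [show g' n = deriv (g n) from funext fun x => (hgd n x).deriv.symm]
    exact (hg n).continuous_deriv (by simp)
  have t1 : Tendsto (fun n => ∫ ω, G ω * g n (F ω) ∂P) atTop (𝓝 (∫ ω, G ω * f (F ω) ∂P)) := by
    have hB : MemLp (fun ω => |f 0| + C * |F ω|) 2 P :=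
      (memLp_const |f 0|).add ((Lp.memLp F).abs.const_mul C)
    refine tendsto_integral_of_dominated_convergence (fun ω => |G ω| * (|f 0| + C * |F ω|))
      (fun n => ((Lp.memLp G).integrable_mul (memLp_comp_of_hasDerivAt (hgd n) (hgC n) F)).1)
      ((Lp.memLp G).abs.integrable_mul hB) (fun n => ae_of_all _ fun ω => ?_)
      (ae_of_all _ fun ω => (hglim _).const_mul _)
    rw [norm_mul, Real.norm_eq_abs, Real.norm_eq_abs]
    refine mul_le_mul_of_nonneg_left ?_ (abs_nonneg _)
    have h1 := abs_le_of_abs_deriv_le (hgd n) (hgC n) (F ω) 0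
    have h2 := abs_sub_abs_le_abs_sub (g n (F ω)) (g n 0)
    rw [sub_zero] at h1
    rw [hg0] at h1 h2
    linarith
  have t2 : Tendsto (fun n => ∫ ω, g' n (F ω) * inner ℝ (U ω) (V ω) ∂P) atTop
      (𝓝 (∫ ω, f' (F ω) * inner ℝ (U ω) (V ω) ∂P)) := by
    refine tendsto_integral_of_dominated_convergence (fun ω => C * ‖(inner ℝ (U ω) (V ω) : ℝ)‖)
      (fun n => ((hg'c n).comp_aestronglyMeasurable (Lp.aestronglyMeasurable F)).mul
        (L2.integrable_inner U V).1) ((L2.integrable_inner U V).norm.const_mul C)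
      (fun n => ae_of_all _ fun ω => ?_) (ae_of_all _ fun ω => (hg'lim _).mul_const _)
    rw [norm_mul]
    exact mul_le_mul_of_nonneg_right (hgC n _) (norm_nonneg _)
  refine tendsto_nhds_unique t1 (t2.congr fun n => ?_)
  exact (stein_identity_of_contDiff hX hV (hg n) (hgd n) (hgC n) hFU).symm

end SteinIdentity

/-! ### Gaussian tail estimates and solutions of Stein's equation -/

section GaussianTail

/-- The standard Gaussian density. -/
local notation "φ" => gaussianPDFReal 0 1

theorem stdGaussian_pos (x : ℝ) : 0 < φ x := gaussianPDFReal_pos 0 1 x one_ne_zero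

theorem stdGaussian_neg (x : ℝ) : φ (-x) = φ x := by simp [gaussianPDFReal]

theorem stdGaussian_le (x : ℝ) : φ x ≤ 2 / 5 := by
  have h1 : φ x = (√(2 * Real.pi))⁻¹ * Real.exp (-x ^ 2 / 2) := by simp [gaussianPDFReal]
  have h2 : Real.exp (-x ^ 2 / 2) ≤ 1 := Real.exp_le_one_iff.2 (by nlinarith [sq_nonneg x])
  have h3 : (5 / 2 : ℝ) ≤ √(2 * Real.pi) := Real.le_sqrt_of_sq_le (by
    nlinarith [Real.pi_gt_d2])
  rw [h1]
  calc _ ≤ (5 / 2 : ℝ)⁻¹ * 1 := by gcongr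
    _ = 2 / 5 := by norm_num

theorem integrable_stdGaussian : Integrable φ := integrable_gaussianPDFReal 0 1

theorem integrable_stdGaussian_mul_id : Integrable fun x => φ x * x :=
  integrable_gaussianReal_iff.1 (memLp_id_gaussianReal (1 : ℝ≥0) |>.integrable (by simp))

theorem tendsto_stdGaussian_atTop : Tendsto φ atTop (𝓝 0) := by
  have e : φ = fun x => (√(2 * Real.pi))⁻¹ * Real.exp (-(x ^ 2 / 2)) := by
    ext x; simp [gaussianPDFReal, neg_div]
  have : Tendsto (fun x : ℝ => x ^ 2 / 2) atTop atTop :=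
    (tendsto_pow_atTop two_ne_zero).atTop_div_const two_pos
  rw [e]
  simpa using (Real.tendsto_exp_neg_atTop_nhds_zero.comp this).const_mul (√(2 * Real.pi))⁻¹

theorem tendsto_stdGaussian_atBot : Tendsto φ atBot (𝓝 0) :=
  (tendsto_stdGaussian_atTop.comp tendsto_neg_atBot_atTop).congr stdGaussian_neg

theorem integral_stdGaussian_Iic_add_Ioi (x : ℝ) :
    (∫ y in Iic x, φ y) + ∫ y in Ioi x, φ y = 1 := by
  rw [← compl_Iic, integral_add_compl measurableSet_Iic integrable_stdGaussian,
    integral_gaussianPDFReal_eq_one 0 one_ne_zero]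

theorem integral_Ioi_stdGaussian_mul_id (x : ℝ) : ∫ y in Ioi x, φ y * y = φ x := by
  have := integral_Ioi_of_hasDerivAt_of_tendsto' (f := fun y => -φ y) (f' := fun y => φ y * y)
    (a := x) (m := 0)
    (fun y _ => (hasDerivAt_gaussianPDFReal y).fun_neg.congr_deriv (by ring))
    integrable_stdGaussian_mul_id.integrableOn (by simpa using tendsto_stdGaussian_atTop.neg)
  simpa using this

theorem integral_Iic_stdGaussian_mul_id (x : ℝ) : ∫ y in Iic x, φ y * y = -φ x := by
  have := integral_Iic_of_hasDerivAt_of_tendsto' (f := fun y => -φ y) (f' := fun y => φ y * y)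
    (a := x) (m := 0)
    (fun y _ => (hasDerivAt_gaussianPDFReal y).fun_neg.congr_deriv (by ring))
    integrable_stdGaussian_mul_id.integrableOn (by simpa using tendsto_stdGaussian_atBot.neg)
  simpa using this

theorem integral_Ioi_stdGaussian_mul_sub (x : ℝ) :
    ∫ y in Ioi x, φ y * (y - x) = φ x - x * ∫ y in Ioi x, φ y := by
  simp only [mul_sub]
  rw [integral_sub integrable_stdGaussian_mul_id.integrableOn
    (integrable_stdGaussian.mul_const x).integrableOn, integral_Ioi_stdGaussian_mul_id,
    integral_mul_const, mul_comm]

theorem integral_Iic_stdGaussian_mul_sub (x : ℝ) :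
    ∫ y in Iic x, φ y * (x - y) = φ x + x * ∫ y in Iic x, φ y := by
  simp only [mul_sub]
  rw [integral_sub (integrable_stdGaussian.mul_const x).integrableOn
    integrable_stdGaussian_mul_id.integrableOn, integral_Iic_stdGaussian_mul_id,
    integral_mul_const]
  ring

/-- The quantity is the Gaussian mean of the positive part of y - x. With its mirror image it
weights the representation of f'. -/
theorem tail_nonneg (x : ℝ) : 0 ≤ φ x - x * ∫ y in Ioi x, φ y := by
  rw [← integral_Ioi_stdGaussian_mul_sub]
  exact setIntegral_nonneg measurableSet_Ioi fun y hy =>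
    mul_nonneg (stdGaussian_pos y).le (sub_nonneg.2 (le_of_lt hy))

theorem head_nonneg (x : ℝ) : 0 ≤ φ x + x * ∫ y in Iic x, φ y := by
  rw [← integral_Iic_stdGaussian_mul_sub]
  exact setIntegral_nonneg measurableSet_Iic fun y hy =>
    mul_nonneg (stdGaussian_pos y).le (sub_nonneg.2 hy)

theorem hasDerivAt_integral_Iic {g : ℝ → ℝ} (hg : Integrable g) (hgc : Continuous g) (x : ℝ) :
    HasDerivAt (fun x => ∫ y in Iic x, g y) (g x) x := by
  have e : (fun x => ∫ y in Iic x, g y) = fun x => (∫ y in Iic 0, g y) + ∫ y in (0 : ℝ)..x, g y := by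
    ext x
    rw [← intervalIntegral.integral_Iic_sub_Iic hg.integrableOn hg.integrableOn]
    ring
  rw [e]
  exact ((hgc.integral_hasStrictDerivAt 0 x).hasDerivAt).const_add _

theorem hasDerivAt_integral_Ioi_stdGaussian (x : ℝ) :
    HasDerivAt (fun x => ∫ y in Ioi x, φ y) (-φ x) x := by
  have e : (fun x => ∫ y in Ioi x, φ y) = fun x => 1 - ∫ y in Iic x, φ y := by
    ext x
    linarith [integral_stdGaussian_Iic_add_Ioi x]
  rw [e]
  exact (hasDerivAt_integral_Iic integrable_stdGaussian continuous_gaussianPDFReal x).const_sub 1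

/-- Birnbaum's lower bound for the Gaussian tail. -/
theorem stdGaussian_mul_le_tail (x : ℝ) :
    φ x * ((√(x ^ 2 + 4) - x) / 2) ≤ ∫ y in Ioi x, φ y := by
  set D : ℝ → ℝ := fun x => (∫ y in Ioi x, φ y) - φ x * ((√(x ^ 2 + 4) - x) / 2) with hD
  have hs : ∀ x : ℝ, 0 < √(x ^ 2 + 4) := fun x => Real.sqrt_pos.2 (by positivity)
  have hs2 : ∀ x : ℝ, √(x ^ 2 + 4) ^ 2 = x ^ 2 + 4 := fun x => Real.sq_sqrt (by positivity)
  have hd : ∀ x, HasDerivAt D (-φ x - (-x * φ x * ((√(x ^ 2 + 4) - x) / 2) +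
      φ x * ((2 * x / (2 * √(x ^ 2 + 4)) - 1) / 2))) x := fun x => by
    have h1 : HasDerivAt (fun x : ℝ => x ^ 2 + 4) (2 * x) x := by
      simpa using (hasDerivAt_pow 2 x).add_const 4
    have h2 := ((h1.sqrt (by positivity)).fun_sub (hasDerivAt_id' x)).div_const 2
    exact (hasDerivAt_integral_Ioi_stdGaussian x).sub ((hasDerivAt_gaussianPDFReal x).fun_mul h2)
  -- A decreasing function with limit 0 at infinity is nonnegative. The sign of the derivative
  -- reduces to x√(x² + 4) ≤ x² + 2.
  have hanti : Antitone D := by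
    refine antitone_of_deriv_nonpos (fun x => (hd x).differentiableAt) fun x => ?_
    rw [(hd x).deriv]
    set s := √(x ^ 2 + 4) with hs'
    have h0 : 0 < s := hs x
    have h2 : s ^ 2 = x ^ 2 + 4 := hs2 x
    have h3 : x * s ≤ x ^ 2 + 2 := abs_le_of_sq_le_sq' (by nlinarith) (by positivity) |>.2
    have h4 : -1 + x * ((s - x) / 2) - (2 * x / (2 * s) - 1) / 2 ≤ 0 := by
      have : -1 + x * ((s - x) / 2) - (2 * x / (2 * s) - 1) / 2 =
          ((s - x) / 2) * (x * s - x ^ 2 - 2) / (2 * s) := by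
        field_simp
        nlinarith
      rw [this]
      have h5 : 0 ≤ s - x := sub_nonneg.2 ((le_abs_self x).trans
        (Real.abs_le_sqrt (by linarith)))
      exact div_nonpos_of_nonpos_of_nonneg
        (mul_nonpos_of_nonneg_of_nonpos (by linarith) (by linarith)) (by linarith)
    have := mul_nonpos_of_nonneg_of_nonpos (stdGaussian_pos x).le h4
    linarith
  have hlim : Tendsto D atTop (𝓝 0) := by
    have t1 : Tendsto (fun x => ∫ y in Ioi x, φ y) atTop (𝓝 0) := by
      have h0 : ∀ x, 0 ≤ ∫ y in Ioi x, φ y := fun x =>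
        setIntegral_nonneg measurableSet_Ioi fun y _ => (stdGaussian_pos y).le
      refine squeeze_zero' (g := φ) (Eventually.of_forall h0) ?_ tendsto_stdGaussian_atTop
      filter_upwards [eventually_ge_atTop 1] with x hx
      nlinarith [tail_nonneg x, h0 x]
    have t2 : Tendsto (fun x => φ x * ((√(x ^ 2 + 4) - x) / 2)) atTop (𝓝 0) := by
      refine squeeze_zero' (g := φ) ?_ ?_ tendsto_stdGaussian_atTop
      · filter_upwards with x
        have h5 : 0 ≤ √(x ^ 2 + 4) - x := sub_nonneg.2 ((le_abs_self x).trans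
          (Real.abs_le_sqrt (by linarith)))
        exact mul_nonneg (stdGaussian_pos x).le (by linarith)
      · filter_upwards [eventually_ge_atTop 0] with x hx
        have : √(x ^ 2 + 4) ≤ x + 2 := Real.sqrt_le_iff.2 ⟨by linarith, by nlinarith⟩
        exact mul_le_of_le_one_right (stdGaussian_pos x).le (by linarith)
    simpa [hD] using t1.sub t2
  exact sub_nonneg.1 (hanti.le_of_tendsto hlim x)

/-- For x ≥ 0 let u be the positive root of u² + xu = 1. Birnbaum's bound gives a tail factor of at
most φ(x)u², and the head factor is x plus the tail factor. With φ ≤ 2/5 the claim becomes 2u - 2u³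
+ (4/5)u⁴ ≤ 1 on [0, 1]. Replacing u⁴ by u³ leaves 2u - (6/5)u³, whose maximum is about 0.994, so
2/5 just suffices. Negative x follow by reflection. -/
theorem two_mul_tail_mul_head_le (x : ℝ) :
    2 * ((φ x - x * ∫ y in Ioi x, φ y) * (φ x + x * ∫ y in Iic x, φ y)) ≤ φ x := by
  have hpos : ∀ x : ℝ, 0 ≤ x →
      2 * ((φ x - x * ∫ y in Ioi x, φ y) * (φ x + x * ∫ y in Iic x, φ y)) ≤ φ x := by
    intro x hx
    have h1 := stdGaussian_mul_le_tail x
    set u := (√(x ^ 2 + 4) - x) / 2 with hu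
    have hs2 : √(x ^ 2 + 4) ^ 2 = x ^ 2 + 4 := Real.sq_sqrt (by positivity)
    have hux : u ^ 2 + x * u = 1 := by rw [hu]; nlinarith
    have hu0 : 0 ≤ u := by
      have := (le_abs_self x).trans (Real.abs_le_sqrt (show x ^ 2 ≤ x ^ 2 + 4 by linarith))
      rw [hu]; linarith
    have hu1 : u ≤ 1 := by nlinarith [mul_nonneg hx hu0]
    have hM0 := tail_nonneg x
    have hΦ := integral_stdGaussian_Iic_add_Ioi x
    set Ψ := ∫ y in Ioi x, φ y
    have hM : φ x - x * Ψ ≤ φ x * u ^ 2 := by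
      have := mul_le_mul_of_nonneg_left h1 hx
      have e : φ x * u ^ 2 = φ x - x * (φ x * u) := by linear_combination φ x * hux
      linarith
    have hφ := stdGaussian_le x
    have hφ0 := stdGaussian_pos x
    have hN : φ x + x * ∫ y in Iic x, φ y = x + (φ x - x * Ψ) := by
      linear_combination x * hΦ
    have hN1 : x + (φ x - x * Ψ) ≤ x + 2 / 5 * u ^ 2 := by nlinarith [sq_nonneg u]
    rw [hN]
    have hkey : (φ x - x * Ψ) * (x + (φ x - x * Ψ)) ≤ φ x * u ^ 2 * (x + 2 / 5 * u ^ 2) :=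
      mul_le_mul hM hN1 (by positivity) (by positivity)
    have poly : 2 * (u ^ 2 * (x + 2 / 5 * u ^ 2)) ≤ 1 := by
      have e : u ^ 2 * x = u - u ^ 3 := by linear_combination u * hux
      have : 2 * u - 2 * u ^ 3 + 4 / 5 * u ^ 4 ≤ 1 := by
        have h3 : u ^ 4 ≤ u ^ 3 := pow_le_pow_of_le_one hu0 hu1 (by norm_num)
        nlinarith [mul_nonneg hu0 (sq_nonneg (u - 3 / 5)), sq_nonneg (u - 3 / 5)]
      linarith
    nlinarith [mul_le_mul_of_nonneg_left poly hφ0.le]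
  rcases le_total 0 x with hx | hx
  · exact hpos x hx
  · have h1 := hpos (-x) (by linarith)
    have e1 : ∫ y in Ioi (-x), φ y = ∫ y in Iic x, φ y := by
      rw [← integral_comp_neg_Iic]
      simp only [stdGaussian_neg]
    have e2 : ∫ y in Iic (-x), φ y = ∫ y in Ioi x, φ y := by
      have := integral_stdGaussian_Iic_add_Ioi x
      have := integral_stdGaussian_Iic_add_Ioi (-x)
      linarith
    rw [e1, e2, stdGaussian_neg] at h1
    linarith

/-- The solution of Stein's equation, together with the representation of its derivative as the
difference between `h` and its mean under a probability measure, which gives the bound. -/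
theorem exists_stein_solution_of_le {h : ℝ → ℝ} (hc : Continuous h)
    (hi : Integrable h (gaussianReal 0 1)) {k : ℝ → ℝ → ℝ} (hk : ∀ x y, |h x - h y| ≤ k x y)
    (hkc : ∀ x, Integrable fun y => φ y * k x y)
    (hb : ∀ x, (φ x - x * ∫ y in Ioi x, φ y) * (∫ y in Iic x, φ y * k x y) +
      (φ x + x * ∫ y in Iic x, φ y) * (∫ y in Ioi x, φ y * k x y) ≤ φ x) :
    ∃ f f' : ℝ → ℝ, (∀ x, HasDerivAt f (f' x) x) ∧ Continuous f' ∧ (∀ x, |f' x| ≤ 1) ∧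
      ∀ x, f' x - x * f x = h x - ∫ y, h y ∂(gaussianReal 0 1) := by
  set c : ℝ := ∫ y, h y ∂(gaussianReal 0 1) with hcdef
  have hi' : Integrable fun y => φ y * h y := integrable_gaussianReal_iff.1 hi
  have hgi : Integrable fun y => φ y * (h y - c) := by
    simp only [mul_sub]
    exact hi'.sub (integrable_stdGaussian.mul_const c)
  have hgc : Continuous fun y => φ y * (h y - c) :=
    continuous_gaussianPDFReal.mul (hc.sub continuous_const)
  set A : ℝ → ℝ := fun x => ∫ y in Iic x, φ y * (h y - c) with hA
  have hφ0 : ∀ x, φ x ≠ 0 := fun x => (stdGaussian_pos x).ne'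
  have hd : ∀ x, HasDerivAt (fun x => A x / φ x) (x * (A x / φ x) + (h x - c)) x := fun x => by
    refine ((hasDerivAt_integral_Iic hgi hgc x).div (hasDerivAt_gaussianPDFReal x)
      (hφ0 x)).congr_deriv ?_
    change (φ x * (h x - c) * φ x - A x * (-x * φ x)) / φ x ^ 2 = _
    have := hφ0 x
    field_simp
    ring
  have hfc : Continuous fun x => A x / φ x :=
    continuous_iff_continuousAt.2 fun x => (hd x).continuousAt
  refine ⟨fun x => A x / φ x, fun x => x * (A x / φ x) + (h x - c), hd, by fun_prop, fun x => ?_,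
    fun x => by ring⟩
  have hΦ := integral_stdGaussian_Iic_add_Ioi x
  have hcs : c = (∫ y in Iic x, φ y * h y) + ∫ y in Ioi x, φ y * h y := by
    rw [hcdef, integral_gaussianReal, intervalIntegral.integral_Iic_add_Ioi hi'.integrableOn
      hi'.integrableOn]
  have hAx : A x = (∫ y in Iic x, φ y * h y) - c * ∫ y in Iic x, φ y := by
    simp only [hA, mul_sub]
    rw [integral_sub hi'.integrableOn (integrable_stdGaussian.mul_const c).integrableOn,
      integral_mul_const, mul_comm c]
  have hdiff : ∀ s : Set ℝ, |(∫ y in s, φ y) * h x - ∫ y in s, φ y * h y| ≤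
      ∫ y in s, φ y * k x y := by
    intro s
    rw [← integral_mul_const, ← integral_sub (integrable_stdGaussian.mul_const _).integrableOn
      hi'.integrableOn, ← Real.norm_eq_abs]
    refine norm_integral_le_of_norm_le (hkc x).integrableOn (ae_of_all _ fun y => ?_)
    rw [← mul_sub, norm_mul, Real.norm_of_nonneg (stdGaussian_pos y).le]
    exact mul_le_mul_of_nonneg_left (hk x y) (stdGaussian_pos y).le
  have d1 := hdiff (Iic x)
  have d2 := hdiff (Ioi x)
  have M0 := tail_nonneg x
  have N0 := head_nonneg x
  have hbx := hb x
  set Φ := ∫ y in Iic x, φ y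
  set Ψ := ∫ y in Ioi x, φ y
  set p := ∫ y in Iic x, φ y * h y
  set q := ∫ y in Ioi x, φ y * h y
  -- The weights φ - xΨ and φ + xΦ are nonnegative, and as Φ + Ψ = 1 they satisfy (φ - xΨ)Φ + (φ +
  -- xΦ)Ψ = φ.
  have e : φ x * (x * (A x / φ x) + (h x - c)) =
      (φ x - x * Ψ) * (Φ * h x - p) + (φ x + x * Φ) * (Ψ * h x - q) := by
    have e1 : φ x * (x * (A x / φ x) + (h x - c)) = x * A x + φ x * (h x - c) := by
      have := hφ0 x
      field_simp
    rw [e1, hAx, hcs, show Φ = 1 - Ψ by linarith]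
    ring
  have hpos := stdGaussian_pos x
  have : |φ x * (x * (A x / φ x) + (h x - c))| ≤ φ x := by
    rw [e]
    refine (abs_add_le _ _).trans ?_
    rw [abs_mul, abs_mul, abs_of_nonneg M0, abs_of_nonneg N0]
    exact (add_le_add (mul_le_mul_of_nonneg_left d1 M0)
      (mul_le_mul_of_nonneg_left d2 N0)).trans hbx
  rw [abs_mul, abs_of_pos hpos] at this
  exact le_of_mul_le_mul_left (by simpa using this) hpos

/-- The oscillation of h is at most 1; with k = 1 the required bound is an equality. -/
theorem exists_stein_solution_of_mem_Icc {h : ℝ → ℝ} (hc : Continuous h)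
    (h01 : ∀ x, h x ∈ Icc (0 : ℝ) 1) :
    ∃ f f' : ℝ → ℝ, (∀ x, HasDerivAt f (f' x) x) ∧ Continuous f' ∧ (∀ x, |f' x| ≤ 1) ∧
      ∀ x, f' x - x * f x = h x - ∫ y, h y ∂(gaussianReal 0 1) := by
  refine exists_stein_solution_of_le hc (Integrable.of_bound hc.aestronglyMeasurable 1
    (ae_of_all _ fun x => ?_)) (k := fun _ _ => 1) (fun x y => ?_) (fun x => ?_) (fun x => ?_)
  · rw [Real.norm_of_nonneg (h01 x).1]
    exact (h01 x).2
  · rw [abs_le]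
    constructor <;> linarith [(h01 x).1, (h01 x).2, (h01 y).1, (h01 y).2]
  · simpa using integrable_stdGaussian
  · have hΦ := integral_stdGaussian_Iic_add_Ioi x
    simp only [mul_one]
    refine le_of_eq ?_
    linear_combination φ x * hΦ

/-- With k = |x - y| the two integrals are the head and tail factors themselves, so the required
bound is twice their product against φ. -/
theorem exists_stein_solution_of_lipschitzWith {h : ℝ → ℝ} (hL : LipschitzWith 1 h) :
    ∃ f f' : ℝ → ℝ, (∀ x, HasDerivAt f (f' x) x) ∧ Continuous f' ∧ (∀ x, |f' x| ≤ 1) ∧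
      ∀ x, f' x - x * f x = h x - ∫ y, h y ∂(gaussianReal 0 1) := by
  have hk : ∀ x y, |h x - h y| ≤ |x - y| := fun x y => by
    simpa [Real.dist_eq] using hL.dist_le_mul x y
  have hid : Integrable (fun x : ℝ => x) (gaussianReal 0 1) :=
    (memLp_id_gaussianReal (1 : ℝ≥0)).integrable (by simp)
  refine exists_stein_solution_of_le hL.continuous ?_ hk (fun x => ?_) (fun x => ?_)
  · refine ((integrable_const |h 0|).add hid.abs).mono' hL.continuous.aestronglyMeasurable
      (ae_of_all _ fun x => ?_)
    have h1 := hk x 0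
    have h2 := abs_sub_abs_le_abs_sub (h x) (h 0)
    rw [sub_zero] at h1
    rw [Real.norm_eq_abs, Pi.add_apply]
    linarith
  · exact integrable_gaussianReal_iff.1 (((integrable_const x).sub hid).abs)
  · have e1 : ∫ y in Iic x, φ y * |x - y| = φ x + x * ∫ y in Iic x, φ y := by
      rw [← integral_Iic_stdGaussian_mul_sub]
      refine setIntegral_congr_fun measurableSet_Iic fun y hy => ?_
      simp only [abs_of_nonneg (sub_nonneg.2 (mem_Iic.1 hy))]
    have e2 : ∫ y in Ioi x, φ y * |x - y| = φ x - x * ∫ y in Ioi x, φ y := by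
      rw [← integral_Ioi_stdGaussian_mul_sub]
      refine setIntegral_congr_fun measurableSet_Ioi fun y hy => ?_
      simp only [abs_sub_comm x y, abs_of_nonneg (sub_nonneg.2 (mem_Ioi.1 hy).le)]
    rw [e1, e2]
    linarith [two_mul_tail_mul_head_le x]

end GaussianTail

/-! ### From Stein solutions to distances between laws -/

section Distances

variable {Ω Ω' H : Type*} [MeasurableSpace Ω] [MeasurableSpace Ω'] [NormedAddCommGroup H]
  [InnerProductSpace ℝ H] {P : Measure Ω} {Q : Measure Ω'} {X : H → Ω → ℝ}

/-- On a probability space the L¹ norm is at most the L² norm. Extended values allow s outside L²,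
as ⟨DF, -DL⁻¹F⟩ is only known to be integrable. -/
theorem ofReal_abs_integral_le_rpow_lintegral_sq [IsProbabilityMeasure P] {g s : Ω → ℝ}
    (hs : AEStronglyMeasurable s P) (hg : ∀ ω, |g ω| ≤ 1) :
    ENNReal.ofReal |∫ ω, g ω * s ω ∂P|
      ≤ (∫⁻ ω, ENNReal.ofReal (s ω ^ 2) ∂P) ^ (1 / 2 : ℝ) := by
  have h2 : (∫⁻ ω, ENNReal.ofReal (s ω ^ 2) ∂P) ^ (1 / 2 : ℝ) = eLpNorm s 2 P := by
    rw [eLpNorm_eq_lintegral_rpow_enorm_toReal (by norm_num) (by norm_num)]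
    simp only [ENNReal.toReal_ofNat, ENNReal.rpow_ofNat]
    congr 1
    refine lintegral_congr fun ω => ?_
    rw [← sq_abs, ENNReal.ofReal_pow (abs_nonneg _), Real.enorm_eq_ofReal_abs]
  rw [h2, ← Real.enorm_eq_ofReal_abs]
  calc ‖∫ ω, g ω * s ω ∂P‖ₑ ≤ ∫⁻ ω, ‖g ω * s ω‖ₑ ∂P := enorm_integral_le_lintegral_enorm _
    _ ≤ ∫⁻ ω, ‖s ω‖ₑ ∂P := by
        refine lintegral_mono fun ω => ?_
        rw [enorm_mul]
        refine mul_le_of_le_one_left zero_le ?_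
        rw [Real.enorm_eq_ofReal_abs]
        exact ENNReal.ofReal_le_one.2 (hg ω)
    _ = eLpNorm s 1 P := eLpNorm_one_eq_lintegral_enorm.symm
    _ ≤ eLpNorm s 2 P := eLpNorm_le_eLpNorm_of_exponent_le (by norm_num) hs

/-- Stein's bound for a test function whose Stein equation has a `C¹` solution with derivative
bounded by one. -/
theorem ofReal_abs_integral_sub_le_steinBound [CompleteSpace H]
    [TopologicalSpace.SeparableSpace H] [IsProbabilityMeasure P] (hX : IsIsonormal X P)
    {Z : Ω' → ℝ} (hZ : HasLaw Z (gaussianReal 0 1) Q) {F : Lp ℝ 2 P} (hF : F ∈ D12 X P)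
    (hF0 : ∫ ω, F ω ∂P = 0) {h : ℝ → ℝ} (hc : Continuous h)
    (hh : ∃ f f' : ℝ → ℝ, (∀ x, HasDerivAt f (f' x) x) ∧ Continuous f' ∧ (∀ x, |f' x| ≤ 1) ∧
      ∀ x, f' x - x * f x = h x - ∫ y, h y ∂(gaussianReal 0 1)) :
    ENNReal.ofReal |(∫ ω, h (F ω) ∂P) - ∫ ω, h (Z ω) ∂Q| ≤ steinBound X P F := by
  obtain ⟨f, f', hf, hf'c, hf'1, hfe⟩ := hh
  obtain ⟨U, hU⟩ := hF
  obtain ⟨V, hV, hdiv⟩ := exists_isMalliavinDeriv_Linv hX hF0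
  have hFm : AEStronglyMeasurable F P := Lp.aestronglyMeasurable F
  have hstein := stein_identity hX hdiv hf hf'c hf'1 hU
  have hif : Integrable (fun ω => F ω * f (F ω)) P :=
    (Lp.memLp F).integrable_mul (memLp_comp_of_hasDerivAt hf hf'1 F)
  have hif' : Integrable (fun ω => f' (F ω)) P :=
    Integrable.of_bound (hf'c.comp_aestronglyMeasurable hFm) 1
      (ae_of_all _ fun ω => by simpa using hf'1 (F ω))
  have hin : Integrable (fun ω => inner ℝ (U ω) ((-V : Lp H 2 P) ω)) P :=
    L2.integrable_inner U (-V)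
  have hif'n : Integrable (fun ω => f' (F ω) * inner ℝ (U ω) ((-V : Lp H 2 P) ω)) P :=
    hin.bdd_mul (c := 1) (hf'c.comp_aestronglyMeasurable hFm)
      (ae_of_all _ fun ω => by simpa using hf'1 (F ω))
  have hZh : ∫ ω, h (Z ω) ∂Q = ∫ y, h y ∂(gaussianReal 0 1) := by
    rw [← hZ.map_eq, integral_map hZ.aemeasurable hc.aestronglyMeasurable]
  have hih : ∀ ω, h (F ω) = (f' (F ω) - F ω * f (F ω)) + ∫ y, h y ∂(gaussianReal 0 1) :=
    fun ω => by rw [hfe]; ring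
  have hid : Integrable (fun ω => f' (F ω) - F ω * f (F ω)) P := hif'.sub hif
  have key : (∫ ω, h (F ω) ∂P) - ∫ ω, h (Z ω) ∂Q
      = ∫ ω, f' (F ω) * (1 - inner ℝ (U ω) ((-V : Lp H 2 P) ω)) ∂P := by
    rw [hZh, integral_congr_ae (ae_of_all _ hih),
      integral_add hid (integrable_const _), integral_sub hif' hif, hstein,
      ← integral_sub hif' hif'n]
    simp [mul_sub]
  rw [key]
  refine (ofReal_abs_integral_le_rpow_lintegral_sq ?_ fun ω => hf'1 (F ω)).trans_eq ?_
  · exact aestronglyMeasurable_const.sub hin.aestronglyMeasurable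
  -- Closability identifies the chosen values of `D` with U and V.
  · rw [steinBound, hU.D_eq hX, hV.D_eq hX]
    congr 1
    refine lintegral_congr_ae ?_
    filter_upwards [Lp.coeFn_neg V] with ω e
    rw [e, Pi.neg_apply]

theorem dFM_le_dW (F : Ω → ℝ) (Z : Ω' → ℝ) : dFM P F Q Z ≤ dW P F Q Z := by
  refine biSup_mono fun h => ?_
  rintro ⟨K, M, hK, -, hKM⟩
  exact hK.weaken (le_self_add.trans hKM)

theorem dKol_le_dTV (F : Ω → ℝ) (Z : Ω' → ℝ) : dKol P F Q Z ≤ dTV P F Q Z := by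
  refine biSup_mono fun h => ?_
  rintro ⟨z, rfl⟩
  exact ⟨Iic z, measurableSet_Iic, rfl⟩

/-- A bound over all continuous test functions with values in `[0, 1]` is a bound for the total
variation distance. -/
theorem dTV_le_of_forall_continuous [IsProbabilityMeasure P] [IsProbabilityMeasure Q]
    {F : Ω → ℝ} {Z : Ω' → ℝ} (hF : AEMeasurable F P) (hZ : AEMeasurable Z Q) {b : ℝ≥0∞}
    (hb : ∀ h : ℝ → ℝ, Continuous h → (∀ x, h x ∈ Icc (0 : ℝ) 1) →
      ENNReal.ofReal |(∫ ω, h (F ω) ∂P) - ∫ ω, h (Z ω) ∂Q| ≤ b) :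
    dTV P F Q Z ≤ b := by
  have : IsProbabilityMeasure (P.map F) := Measure.isProbabilityMeasure_map hF
  have : IsProbabilityMeasure (Q.map Z) := Measure.isProbabilityMeasure_map hZ
  refine iSup₂_le ?_
  rintro _ ⟨B, hB, rfl⟩
  set u : ℝ → ℝ := B.indicator fun _ => 1 with hu
  have hum : Measurable u := measurable_const.indicator hB
  have hu01 : ∀ x, u x ∈ Icc (0 : ℝ) 1 := fun x => by
    by_cases hx : x ∈ B <;> simp [hu, hx]
  refine ENNReal.le_of_forall_pos_le_add fun ε hε _ => ?_
  have hε' : (0 : ℝ) < ε := hε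
  have hint : ∀ (ν : Measure ℝ) [IsFiniteMeasure ν] (g : ℝ → ℝ), Measurable g →
      (∀ x, g x ∈ Icc (0 : ℝ) 1) → Integrable g ν := fun ν _ g hg hg01 =>
    Integrable.of_bound hg.aestronglyMeasurable 1
      (ae_of_all _ fun x => by rw [Real.norm_eq_abs, abs_of_nonneg (hg01 x).1]; exact (hg01 x).2)
  -- Approximating in L¹ of the sum of the laws yields one function good for both. Clamping it to
  -- [0, 1] does not increase the error, since u already takes values there.
  obtain ⟨g, hg, -⟩ := (hint (P.map F + Q.map Z) u hum hu01).exists_boundedContinuous_integral_sub_le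
    hε'
  set k : ℝ → ℝ := fun x => max 0 (min 1 (g x)) with hk
  have hkc : Continuous k := by fun_prop
  have hk01 : ∀ x, k x ∈ Icc (0 : ℝ) 1 := fun x =>
    ⟨le_max_left _ _, max_le zero_le_one (min_le_left _ _)⟩
  have hle : ∀ x, |u x - k x| ≤ ‖u x - g x‖ := fun x => by
    have h1 : u x = max 0 (min 1 (u x)) := by rw [min_eq_right (hu01 x).2, max_eq_right (hu01 x).1]
    rw [Real.norm_eq_abs]
    conv_lhs => rw [h1]
    exact (abs_max_sub_max_le_max _ _ _ _).trans (by
      rw [sub_self, abs_zero]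
      refine max_le (abs_nonneg _) ((abs_min_sub_min_le_max _ _ _ _).trans ?_)
      simp)
  have hku : ∀ (ν : Measure ℝ) [IsFiniteMeasure ν], Integrable (fun x => |u x - k x|) ν :=
    fun ν _ => ((hint ν u hum hu01).sub (hint ν k hkc.measurable hk01)).abs
  have hsum : (∫ x, |u x - k x| ∂(P.map F)) + ∫ x, |u x - k x| ∂(Q.map Z) ≤ ε := by
    rw [← integral_add_measure (hku _) (hku _)]
    refine (integral_mono (hku _) ?_ hle).trans hg
    exact ((hint _ u hum hu01).sub (g.integrable _)).norm
  have hdiff : ∀ (ν : Measure ℝ) [IsFiniteMeasure ν],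
      |(∫ x, u x ∂ν) - ∫ x, k x ∂ν| ≤ ∫ x, |u x - k x| ∂ν := fun ν _ => by
    rw [← integral_sub (hint ν u hum hu01) (hint ν k hkc.measurable hk01)]
    exact abs_integral_le_integral_abs
  have hb' := hb k hkc hk01
  rw [← integral_map hF hkc.aestronglyMeasurable, ← integral_map hZ hkc.aestronglyMeasurable] at hb'
  rw [← integral_map hF hum.aestronglyMeasurable, ← integral_map hZ hum.aestronglyMeasurable]
  have hd1 := hdiff (P.map F)
  have hd2 := hdiff (Q.map Z)
  have htri : |(∫ x, u x ∂(P.map F)) - ∫ x, u x ∂(Q.map Z)|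
      ≤ |(∫ x, k x ∂(P.map F)) - ∫ x, k x ∂(Q.map Z)| + ε := by
    rw [abs_le] at hd1 hd2 ⊢
    have h3 := le_abs_self ((∫ x, k x ∂(P.map F)) - ∫ x, k x ∂(Q.map Z))
    have h4 := neg_abs_le ((∫ x, k x ∂(P.map F)) - ∫ x, k x ∂(Q.map Z))
    constructor <;> linarith
  refine (ENNReal.ofReal_le_ofReal htri).trans ?_
  rw [ENNReal.ofReal_add (abs_nonneg _) hε'.le, ENNReal.ofReal_coe_nnreal]
  gcongr

end Distances

end Malliavin

/-! ### The main theorem -/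

theorem theorem3p1 {Ω Ω' H : Type*} [MeasurableSpace Ω] [MeasurableSpace Ω']
    [NormedAddCommGroup H] [InnerProductSpace ℝ H] [CompleteSpace H]
    [TopologicalSpace.SeparableSpace H]
    (P : Measure Ω) [IsProbabilityMeasure P] (Q : Measure Ω') [IsProbabilityMeasure Q]
    (X : H → Ω → ℝ) (hX : Malliavin.IsIsonormal X P)
    (Z : Ω' → ℝ) (hZ : HasLaw Z (gaussianReal 0 1) Q)
    (F : Lp ℝ 2 P) (hF : F ∈ Malliavin.D12 X P) (hF0 : ∫ ω, F ω ∂P = 0) :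
    Malliavin.Linv X P F ∈ Malliavin.D12 X P ∧
    Malliavin.dW P F Q Z ≤ Malliavin.steinBound X P F ∧
    Malliavin.dFM P F Q Z ≤ 4 * Malliavin.steinBound X P F ∧
    (P.map F ≪ volume →
      Malliavin.dKol P F Q Z ≤ Malliavin.steinBound X P F ∧
      Malliavin.dTV P F Q Z ≤ 2 * Malliavin.steinBound X P F) := by
  have hW : Malliavin.dW P F Q Z ≤ Malliavin.steinBound X P F :=
    iSup₂_le fun h hL => Malliavin.ofReal_abs_integral_sub_le_steinBound hX hZ hF hF0
      (LipschitzWith.continuous hL) (Malliavin.exists_stein_solution_of_lipschitzWith hL)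
  have hTV : Malliavin.dTV P F Q Z ≤ Malliavin.steinBound X P F :=
    Malliavin.dTV_le_of_forall_continuous (Lp.aestronglyMeasurable F).aemeasurable hZ.aemeasurable
      fun h hc h01 => Malliavin.ofReal_abs_integral_sub_le_steinBound hX hZ hF hF0 hc
        (Malliavin.exists_stein_solution_of_mem_Icc hc h01)
  -- The factors 4 and 2 only weaken bounds already obtained with constant 1.
  have hmul : ∀ {c : ℝ≥0∞}, 1 ≤ c →
      Malliavin.steinBound X P F ≤ c * Malliavin.steinBound X P F := fun hc =>
    le_mul_of_one_le_left zero_le hc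
  obtain ⟨V, hV, -⟩ := Malliavin.exists_isMalliavinDeriv_Linv hX hF0
  exact ⟨⟨V, hV⟩, hW, ((Malliavin.dFM_le_dW _ _).trans hW).trans (hmul (by norm_num)),
    fun _ => ⟨(Malliavin.dKol_le_dTV _ _).trans hTV, hTV.trans (hmul (by norm_num))⟩⟩
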